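/- Let $d \ge 1$ be an integer. For $\delta \in (0,1)$ and $\omega \in \mathbb{R}^d$ put $$\tau_{\omega} = \{(\xi,\eta) \in \mathbb{R}^d\times\mathbb{R} : |\xi_i - \omega_i| \le \delta \text{ for } i=1,\dots,d,\ |\eta - 2\omega\cdot(\xi-\omega) - |\omega|^2| \le 2d\delta^2\},$$ and for $\tau \subset \mathbb{R}^{d+1}$ let $P_\tau f = (\widehat{f}\,1_\tau)^{\vee}$, where $\widehat f(\zeta)=\int f(z)e^{-2\pi i z\cdot\zeta}\,dz$. For $1 \le q,r \le \infty$ let $$\|F\|_{L^q_tL^r_x} = \Big(\int_{\mathbb{R}}\Big(\int_{\mathbb{R}^d}|F(x,t)|^r\,dx\Big)^{q/r}dt\Big)^{1/q},$$ with essential suprema in place of integrals for infinite exponents. For a finite set $\Xi\subset[-1,1]^d$ let $D_{q,r}(\delta,\Xi)\in[0,\infty]$ be the best (smallest) constant $D$ such that $$\Big\|\sum_{\omega\in\Xi}P_{\tau_\omega}f\Big\|_{L^q_tL^r_x} \le D\,\Big(\sum_{\omega\in\Xi}\|P_{\tau_\omega}f\|_{L^q_tL^r_x}^2\Big)^{1/2}$$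 for all Schwartz functions $f$ on $\mathbb{R}^d\times\mathbb{R}$ whose Fourier transform is supported in $\bigcup_{\omega\in\Xi}\tau_\omega$. A maximal $\delta$-net of $[-1,1]^d$ is a subset of $[-1,1]^d$ whose distinct points are at Euclidean distance at least $\delta$ from each other, and which is maximal with respect to inclusion among such subsets (it is necessarily finite). Then there is $\delta_0 > 0$ depending only on $d$ such that for all $1 \le q,r\le\infty$ there is a constant $c>0$ depending only on $d,q,r$ such that, for every $0<\delta<\delta_0$ and every maximal $\delta$-net $\Xi$ of $[-1,1]^d$, $$D_{q,r}(\delta,\Xi) \ \ge\ c\,\max\Big(\delta^{-(\frac d2-\frac dr-\frac 2q)},\ \delta^{-d(\frac1r-\frac12)},\ \delta^{-d(\frac1q-\frac12)},\ \delta^{-(\frac d2-\frac{d+2}{r})}\Big),$$ where $1/\infty = 0$. -/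

import Mathlib

open MeasureTheory
open scoped ENNReal FourierTransform SchwartzMap

noncomputable section

namespace MixedDecoupling

/-- The spatial (or spatial frequency) space `ℝ^d`, with its Euclidean norm. -/
abbrev Space (d : ℕ) : Type := EuclideanSpace ℝ (Fin d)

/-- Space-time `ℝ^d × ℝ` with its Euclidean inner product; a point is `(x, t)`
(or `(ξ, η)` on the frequency side), read as `p.fst`, `p.snd`. -/
abbrev SpaceTime (d : ℕ) : Type := WithLp 2 (Space d × ℝ)

/-- The cube `[-1, 1]^d`. -/
def cube (d : ℕ) : Set (Space d) := {x | ∀ i, x i ∈ Set.Icc (-1 : ℝ) 1}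

/-- A subset of `[-1, 1]^d` whose distinct points are at (Euclidean) distance at least `δ`. -/
def IsSeparatedIn (d : ℕ) (δ : ℝ) (S : Set (Space d)) : Prop :=
  S ⊆ cube d ∧ S.Pairwise fun x y => δ ≤ dist x y

/-- A maximal `δ`-net of `[-1, 1]^d`: a `δ`-separated subset, maximal for inclusion. -/
def IsMaximalNet (d : ℕ) (δ : ℝ) (S : Set (Space d)) : Prop :=
  Maximal (IsSeparatedIn d δ) S

/-- The parallelepiped `τ_ω = τ_{ω,δ}`. -/
def tau (d : ℕ) (δ : ℝ) (ω : Space d) : Set (SpaceTime d) :=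
  {p | (∀ i, |p.fst i - ω i| ≤ δ) ∧
    |p.snd - 2 * inner ℝ ω (p.fst - ω) - ‖ω‖ ^ 2| ≤ 2 * (d : ℝ) * δ ^ 2}

/-- The Fourier projection `P_τ f = (f̂ 1_τ)^∨` (with `f̂(ζ) = ∫ f(z) e^{-2πi z·ζ} dz`). -/
def proj {d : ℕ} (τ : Set (SpaceTime d)) (f : 𝓢(SpaceTime d, ℂ)) : SpaceTime d → ℂ :=
  𝓕⁻ (τ.indicator (𝓕 (f : SpaceTime d → ℂ)))

/-- The mixed norm `‖F‖_{L^q_t L^r_x(ℝ^d × ℝ)}`, with values in `[0, ∞]`; for an infinite exponent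
it is the essential supremum. -/
def mixedNorm {d : ℕ} (q r : ℝ≥0∞) (F : SpaceTime d → ℂ) : ℝ≥0∞ :=
  eLpNorm (fun t : ℝ => eLpNorm (fun x : Space d => F (WithLp.toLp 2 (x, t))) r volume) q volume

/-- `C` is admissible if the decoupling inequality holds with constant `C` for every Schwartz
function `f` whose Fourier transform is supported in `⋃_{ω ∈ Ξ} τ_ω`. -/
def DecouplingBound (d : ℕ) (q r : ℝ≥0∞) (δ : ℝ) (Ξ : Finset (Space d)) (C : ℝ≥0∞) : Prop :=
  ∀ f : 𝓢(SpaceTime d, ℂ),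
    Function.support (𝓕 (f : SpaceTime d → ℂ)) ⊆ ⋃ ω ∈ Ξ, tau d δ ω →
    mixedNorm q r (∑ ω ∈ Ξ, proj (tau d δ ω) f) ≤
      C * (∑ ω ∈ Ξ, mixedNorm q r (proj (tau d δ ω) f) ^ 2) ^ (1 / 2 : ℝ)

/-- The decoupling constant `D_{q,r}(δ, Ξ)`: the best constant in the decoupling inequality.
Testing only Schwartz functions gives the smallest such constant, so that a lower bound for it
is a lower bound for the constant of any larger class of test functions. -/
def decouplingConst (d : ℕ) (q r : ℝ≥0∞) (δ : ℝ) (Ξ : Finset (Space d)) : ℝ≥0∞ :=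
  sInf {C | DecouplingBound d q r δ Ξ C}

end MixedDecoupling

end

/-! The constant is tested on superpositions of wave packets. A packet of frequency `ξ` has
amplitude about one on a tube of spatial width `δ⁻¹` around `x = -2tξ`, for `|t| ≲ δ⁻²`, so its
mixed norm is comparable to `δ^(-d/r) δ^(-2/q)`. Let `N` be the number of net points; then `N ≈
δ^(-d)`.

Three placements of the packets give the four powers. Focusing: for each frequency, `M ≤ δ⁻²`
packets pass through `M` common points, which are far apart in space and occupy consecutive
unit-size time slots. Near each point the `N` frequencies add coherently. The quotient of the two
sides is about `N^(1/2) M^(1/q - 1/r) δ^(d/r + 2/q)`; `M = 1` gives the first power and `M ≈ δ⁻²`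
the fourth. Separation in space: `N` disjoint tubes alive at the same times give `N^(1/r - 1/2)`,
the second power. Separation in time: `N` packets with disjoint lifetimes give `N^(1/q - 1/2)`, the
third power.

The sets `τ_ω` overlap and their cutoffs are sharp. `exists_frequencies` therefore moves each `ω`
slightly, so that the Fourier support of each packet is either inside or disjoint from every `τ_ω'`.
Each projection is then a sum over boundedly many frequencies, and the full sum carries
multiplicities between `1` and a dimensional constant (`nonempty_packetFamily`). The upper bounds
come from `PacketFamily.mixedNorm_sum_packet_le`, the lower bounds from the three
`_le_decouplingConst` examples. -/

namespace MixedDecoupling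

/-! ### Bounds for mixed norms -/

/-- Interpolation between `L¹` and `L^∞`: `|f|^p ≤ S^(p-1) |f|`. Since `(∞⁻¹).toReal = 0`, one
formula covers every exponent. -/
theorem eLpNorm_le_of_sup_le_of_lintegral_le {α ε : Type*} [MeasurableSpace α] {μ : Measure α}
    [ENorm ε] {f : α → ε} {p A S : ℝ≥0∞} (hp : 1 ≤ p) (hS : S ≠ ∞)
    (hsup : ∀ x, ‖f x‖ₑ ≤ S) (hint : ∫⁻ x, ‖f x‖ₑ ∂μ ≤ A * S) :
    eLpNorm f p μ ≤ A ^ (p⁻¹).toReal * S := by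
  rcases eq_or_ne p ∞ with rfl | hp'
  · simpa using eLpNormEssSup_le_of_ae_enorm_bound (Filter.Eventually.of_forall hsup)
  have hp1 : 1 ≤ p.toReal := by
    simpa using ENNReal.toReal_mono hp' hp
  have h0 : p ≠ 0 := (zero_lt_one.trans_le hp).ne'
  rw [eLpNorm_eq_lintegral_rpow_enorm_toReal h0 hp', ENNReal.toReal_inv, one_div]
  have h1 : ∀ x, ‖f x‖ₑ ^ p.toReal ≤ S ^ (p.toReal - 1) * ‖f x‖ₑ := fun x => by
    calc ‖f x‖ₑ ^ p.toReal = ‖f x‖ₑ ^ ((p.toReal - 1) + 1) := by ring_nf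
      _ = ‖f x‖ₑ ^ (p.toReal - 1) * ‖f x‖ₑ := by
        rw [ENNReal.rpow_add_of_nonneg _ _ (by linarith) zero_le_one, ENNReal.rpow_one]
      _ ≤ _ := by gcongr; exact hsup x
  have h2 : ∫⁻ x, ‖f x‖ₑ ^ p.toReal ∂μ ≤ A * S ^ p.toReal := by
    calc ∫⁻ x, ‖f x‖ₑ ^ p.toReal ∂μ ≤ ∫⁻ x, S ^ (p.toReal - 1) * ‖f x‖ₑ ∂μ := lintegral_mono h1
      _ = S ^ (p.toReal - 1) * ∫⁻ x, ‖f x‖ₑ ∂μ :=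
        lintegral_const_mul' _ _ (ENNReal.rpow_ne_top_of_nonneg (by linarith) hS)
      _ ≤ S ^ (p.toReal - 1) * (A * S) := by gcongr
      _ = A * S ^ ((p.toReal - 1) + 1) := by
        rw [ENNReal.rpow_add_of_nonneg _ _ (by linarith) zero_le_one, ENNReal.rpow_one]; ring
      _ = _ := by ring_nf
  calc _ ≤ (A * S ^ p.toReal) ^ (p.toReal)⁻¹ := by gcongr
    _ = _ := by
      rw [ENNReal.mul_rpow_of_nonneg _ _ (by positivity), ← ENNReal.rpow_mul,
        mul_inv_cancel₀ (by linarith), ENNReal.rpow_one]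

theorem le_eLpNorm_of_le_on {α ε : Type*} [MeasurableSpace α] {μ : Measure α}
    [ENorm ε] {f : α → ε} {p a : ℝ≥0∞} {s : Set α} (hp : p ≠ 0) (hs : MeasurableSet s)
    (h0 : μ s ≠ 0) (h : ∀ x ∈ s, a ≤ ‖f x‖ₑ) :
    a * μ s ^ (p⁻¹).toReal ≤ eLpNorm f p μ := by
  have := eLpNorm_indicator_const' (c := a) hs h0 hp
  rw [ENNReal.toReal_inv, ← one_div]
  simp only [enorm_eq_self] at this
  rw [← this]
  refine eLpNorm_mono_enorm fun x => ?_
  by_cases hx : x ∈ s <;> simp [hx, h]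

/-- The interpolation bound is applied in `x` at fixed `t`, then in `t` to the envelope `V`. -/
theorem mixedNorm_le {d : ℕ} {q r A B S : ℝ≥0∞} (hq : 1 ≤ q) (hr : 1 ≤ r) (hS : S ≠ ∞)
    (hA : A ≠ ∞) {G : SpaceTime d → ℂ} {V : ℝ → ℝ≥0∞}
    (h1 : ∀ t x, ‖G (WithLp.toLp 2 (x, t))‖ₑ ≤ V t)
    (h2 : ∀ t, ∫⁻ x : Space d, ‖G (WithLp.toLp 2 (x, t))‖ₑ ≤ A * V t)
    (h3 : ∀ t, V t ≤ S) (h4 : ∫⁻ t, V t ≤ B * S) :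
    mixedNorm q r G ≤ A ^ (r⁻¹).toReal * B ^ (q⁻¹).toReal * S := by
  have hA' : A ^ (r⁻¹).toReal ≠ ∞ := ENNReal.rpow_ne_top_of_nonneg (by positivity) hA
  have key : ∀ t, eLpNorm (fun x : Space d => G (WithLp.toLp 2 (x, t))) r volume ≤
      A ^ (r⁻¹).toReal * V t := fun t =>
    eLpNorm_le_of_sup_le_of_lintegral_le hr (ne_top_of_le_ne_top hS (h3 t)) (h1 t) (h2 t)
  rw [mul_comm (A ^ _), mul_assoc]
  refine eLpNorm_le_of_sup_le_of_lintegral_le hq (ENNReal.mul_ne_top hA' hS) (fun t => ?_) ?_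
  · rw [enorm_eq_self]
    exact (key t).trans (by gcongr; exact h3 t)
  · simp only [enorm_eq_self]
    calc _ ≤ ∫⁻ t, A ^ (r⁻¹).toReal * V t := lintegral_mono key
      _ = A ^ (r⁻¹).toReal * ∫⁻ t, V t := lintegral_const_mul' _ _ hA'
      _ ≤ A ^ (r⁻¹).toReal * (B * S) := by gcongr
      _ = _ := by ring

theorem le_mixedNorm {d : ℕ} {q r X a : ℝ≥0∞} (hq : q ≠ 0) (hr : r ≠ 0) (hX : X ≠ 0)
    {G : SpaceTime d → ℂ} {T : Set ℝ} (hT : MeasurableSet T) (hT0 : volume T ≠ 0)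
    (h : ∀ t ∈ T, ∃ s : Set (Space d), MeasurableSet s ∧ X ≤ volume s ∧
      ∀ x ∈ s, a ≤ ‖G (WithLp.toLp 2 (x, t))‖ₑ) :
    a * X ^ (r⁻¹).toReal * volume T ^ (q⁻¹).toReal ≤ mixedNorm q r G := by
  refine le_eLpNorm_of_le_on hq hT hT0 fun t ht => ?_
  obtain ⟨s, hs, hXs, hs'⟩ := h t ht
  rw [enorm_eq_self]
  refine le_trans ?_ (le_eLpNorm_of_le_on hr hs (fun h0 => hX (by simpa [h0] using hXs)) hs')
  gcongr

/-! ### Polynomially decaying weights -/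

/-- The weight `(1 + ‖u‖)^{-k}`. -/
noncomputable def decay {E : Type*} [NormedAddCommGroup E] (k : ℕ) (u : E) : ℝ :=
  ((1 + ‖u‖) ^ k)⁻¹

section decay
variable {E : Type*} [NormedAddCommGroup E]

theorem decay_pos (k : ℕ) (u : E) : 0 < decay k u := by
  unfold decay; positivity

theorem decay_le_one (k : ℕ) (u : E) : decay k u ≤ 1 :=
  inv_le_one_of_one_le₀ (one_le_pow₀ (by linarith [norm_nonneg u]))

theorem decay_le_inv {k : ℕ} (hk : k ≠ 0) {u : E} {Λ : ℝ} (h0 : 0 < Λ) (h : Λ ≤ ‖u‖) :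
    decay k u ≤ Λ⁻¹ := by
  unfold decay
  gcongr
  calc Λ ≤ 1 + ‖u‖ := by linarith
    _ ≤ _ := le_self_pow₀ (by linarith) hk

/-- If the points `u j` are `2 #J`-separated, then the sum of the weights centred there
is bounded independently of their number. -/
theorem sum_decay_le_two {ι : Type*} {k : ℕ} (hk : k ≠ 0) (J : Finset ι) (u : ι → E)
    (h : ∀ i ∈ J, ∀ j ∈ J, i ≠ j → 2 * (J.card : ℝ) ≤ ‖u i - u j‖) :
    ∑ j ∈ J, decay k (u j) ≤ 2 := by
  classical
  -- By separation at most one point lies within `#J` of the origin. It contributes at most `1`, and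
  -- all the others together at most `#J · (#J)⁻¹`.
  by_cases hJ : ∃ i ∈ J, ‖u i‖ < J.card
  · obtain ⟨i, hi, hlt⟩ := hJ
    have hpos : (0 : ℝ) < J.card := by exact_mod_cast Finset.card_pos.mpr ⟨i, hi⟩
    rw [← Finset.add_sum_erase _ _ hi]
    have h1 : ∑ j ∈ J.erase i, decay k (u j) ≤ ∑ j ∈ J.erase i, (J.card : ℝ)⁻¹ := by
      refine Finset.sum_le_sum fun j hj => decay_le_inv hk hpos ?_
      have h2 := h i hi j (Finset.mem_of_mem_erase hj) (Finset.ne_of_mem_erase hj).symm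
      have h3 := norm_sub_le (u i) (u j)
      linarith
    have h2 : ∑ j ∈ J.erase i, (J.card : ℝ)⁻¹ ≤ 1 := by
      rw [Finset.sum_const, nsmul_eq_mul]
      calc _ ≤ (J.card : ℝ) * (J.card : ℝ)⁻¹ := by
            gcongr; exact Finset.erase_subset _ _
        _ ≤ 1 := mul_inv_le_one
    linarith [decay_le_one k (u i)]
  · push Not at hJ
    calc ∑ j ∈ J, decay k (u j) ≤ ∑ j ∈ J, (J.card : ℝ)⁻¹ := by
          refine Finset.sum_le_sum fun j hj => decay_le_inv hk ?_ (hJ j hj)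
          exact_mod_cast Finset.card_pos.mpr ⟨j, hj⟩
      _ = (J.card : ℝ) * (J.card : ℝ)⁻¹ := by rw [Finset.sum_const, nsmul_eq_mul]
      _ ≤ 2 := mul_inv_le_one.trans one_le_two

theorem continuous_decay (k : ℕ) : Continuous (decay k : E → ℝ) := by
  unfold decay
  exact Continuous.inv₀ (by fun_prop) fun u => by positivity

variable [NormedSpace ℝ E] [FiniteDimensional ℝ E] [MeasurableSpace E] [BorelSpace E]

theorem lintegral_decay_lt_top {k : ℕ} (hk : Module.finrank ℝ E < k) (μ : Measure E)
    [μ.IsAddHaarMeasure] : ∫⁻ u, ENNReal.ofReal (decay k u) ∂μ < ∞ := by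
  have := finite_integral_one_add_norm (μ := μ) (r := k) (by exact_mod_cast hk)
  refine lt_of_eq_of_lt (lintegral_congr fun u => ?_) this
  rw [decay, Real.rpow_neg (by positivity), Real.rpow_natCast]

theorem lintegral_decay_smul_sub (k : ℕ) (μ : Measure E) [μ.IsAddHaarMeasure] {c : ℝ}
    (hc : 0 < c) (a : E) :
    ∫⁻ u, ENNReal.ofReal (decay k (c • (u - a))) ∂μ =
      ENNReal.ofReal ((c ^ Module.finrank ℝ E)⁻¹) * ∫⁻ u, ENNReal.ofReal (decay k u) ∂μ := by
  rw [lintegral_sub_right_eq_self (fun u => ENNReal.ofReal (decay k (c • u))) a]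
  have h := Measure.map_addHaar_smul μ hc.ne'
  rw [abs_of_pos (by positivity)] at h
  rw [← smul_eq_mul, ← lintegral_smul_measure, ← h, lintegral_map]
  · exact (continuous_decay k).measurable.ennreal_ofReal
  · fun_prop

end decay

/-! ### Separated sets -/

/-- Volume packing: the balls of radius `δ / 2` about the points are disjoint and lie in one ball of
radius `R + δ / 2`. -/
theorem card_le_of_separated_of_dist_le {E : Type*} [NormedAddCommGroup E] [NormedSpace ℝ E]
    [FiniteDimensional ℝ E] (s : Finset E) {δ R : ℝ} (hδ : 0 < δ) (hR : 0 ≤ R) (x : E)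
    (hs : ∀ c ∈ s, dist c x ≤ R) (h : (s : Set E).Pairwise fun c c' => δ ≤ dist c c') :
    (s.card : ℝ) ≤ (2 * R / δ + 1) ^ Module.finrank ℝ E := by
  borelize E
  let μ : Measure E := Measure.addHaar
  have D : (s : Set E).PairwiseDisjoint fun c => Metric.ball c (δ / 2) := by
    intro c hc c' hc' hne
    exact Metric.ball_disjoint_ball (by linarith [h hc hc' hne])
  have A : (⋃ c ∈ s, Metric.ball c (δ / 2)) ⊆ Metric.ball x (R + δ / 2) := by
    refine Set.iUnion₂_subset fun c hc => Metric.ball_subset_ball' ?_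
    linarith [hs c hc]
  have I : (s.card : ℝ≥0∞) * ENNReal.ofReal ((δ / 2) ^ Module.finrank ℝ E) * μ (Metric.ball 0 1) ≤
      ENNReal.ofReal ((R + δ / 2) ^ Module.finrank ℝ E) * μ (Metric.ball 0 1) := by
    calc _ = μ (⋃ c ∈ s, Metric.ball c (δ / 2)) := by
          rw [measure_biUnion_finset D fun c _ => measurableSet_ball]
          simp only [Measure.addHaar_ball_of_pos μ _ (half_pos hδ), Finset.sum_const,
            nsmul_eq_mul, mul_assoc]
      _ ≤ μ (Metric.ball x (R + δ / 2)) := measure_mono A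
      _ = _ := Measure.addHaar_ball_of_pos μ _ (by linarith)
  have J := (ENNReal.mul_le_mul_iff_left (Metric.measure_ball_pos _ _ zero_lt_one).ne'
    measure_ball_lt_top.ne).1 I
  rw [← ENNReal.ofReal_natCast, ← ENNReal.ofReal_mul (by positivity),
    ENNReal.ofReal_le_ofReal_iff (by positivity)] at J
  calc (s.card : ℝ) ≤ (R + δ / 2) ^ Module.finrank ℝ E / (δ / 2) ^ Module.finrank ℝ E := by
        rwa [le_div_iff₀ (by positivity)]
    _ = _ := by
        rw [← div_pow]; congr 1; field_simp

/-- An interval of length `δ` contains a point which stays away from `#P` given points. -/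
theorem exists_far_from_finset (P : Finset ℝ) (a : ℝ) {δ : ℝ} (hδ : 0 < δ) {n : ℕ}
    (hP : P.card ≤ n) :
    ∃ x ∈ Set.Icc a (a + δ), ∀ p ∈ P, δ / (2 * (n + 1)) ≤ |x - p| := by
  by_contra! hcon
  have hn : (0 : ℝ) < n + 1 := by positivity
  have hmem : ∀ k ∈ Finset.range (n + 1), a + k * (δ / (n + 1)) ∈ Set.Icc a (a + δ) := by
    intro k hk
    have : (k : ℝ) ≤ n + 1 := by exact_mod_cast (Finset.mem_range.1 hk).le
    refine ⟨by linarith [show 0 ≤ k * (δ / (n + 1)) by positivity], ?_⟩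
    have : (k : ℝ) * (δ / (n + 1)) ≤ (n + 1) * (δ / (n + 1)) := by gcongr
    rw [mul_div_cancel₀ _ hn.ne'] at this
    linarith
  -- Pigeonhole: `n + 1` candidates spaced by `δ / (n + 1)` cannot all be close to at most `n`
  -- points, since two would share the same one.
  choose! p hpP hp using fun k hk => hcon _ (hmem k hk)
  obtain ⟨i, hi, j, hj, hij, hpij⟩ :=
    Finset.exists_ne_map_eq_of_card_lt_of_maps_to (s := Finset.range (n + 1)) (t := P)
      (by simpa using Nat.lt_succ_of_le hP) hpP
  have h1 := hp i hi
  have h2 := hp j hj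
  rw [hpij] at h1
  have h3 : |((i : ℝ) - j) * (δ / (n + 1))| < δ / (n + 1) := by
    calc _ = |(a + i * (δ / (n + 1)) - p j) - (a + j * (δ / (n + 1)) - p j)| := by ring_nf
      _ ≤ _ := abs_sub _ _
      _ < δ / (2 * (n + 1)) + δ / (2 * (n + 1)) := add_lt_add h1 h2
      _ = _ := by field_simp; norm_num
  rw [abs_mul, abs_of_pos (show 0 < δ / (n + 1) by positivity)] at h3
  have h4 : |(i : ℝ) - j| < 1 := by
    have : 0 < δ / (n + 1) := by positivity
    nlinarith
  have h5 : |(i : ℤ) - j| < 1 := by exact_mod_cast h4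
  rw [Int.abs_lt_one_iff] at h5
  omega

/-! ### Nets -/

theorem norm_sq_le_of_abs_le {d : ℕ} {x : Space d} {b : ℝ} (h : ∀ i, |x i| ≤ b) :
    ‖x‖ ^ 2 ≤ d * b ^ 2 := by
  rw [EuclideanSpace.real_norm_sq_eq]
  calc ∑ i, x i ^ 2 ≤ ∑ _i : Fin d, b ^ 2 :=
        Finset.sum_le_sum fun i _ => sq_le_sq' (abs_le.1 (h i)).1 (abs_le.1 (h i)).2
    _ = _ := by simp

theorem norm_le_of_abs_le {d : ℕ} {x : Space d} {b : ℝ} (hb : 0 ≤ b) (h : ∀ i, |x i| ≤ b) :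
    ‖x‖ ≤ √d * b := by
  refine le_of_sq_le_sq ?_ (by positivity)
  rw [mul_pow, Real.sq_sqrt (by positivity)]
  exact norm_sq_le_of_abs_le h

theorem IsMaximalNet.exists_dist_lt {d : ℕ} {δ : ℝ} (hδ : 0 < δ) {S : Set (Space d)}
    (hS : IsMaximalNet d δ S) {x : Space d} (hx : x ∈ cube d) : ∃ ω ∈ S, dist x ω < δ := by
  by_contra! h
  have hsep : IsSeparatedIn d δ (insert x S) := by
    refine ⟨Set.insert_subset hx hS.prop.1, ?_⟩
    refine hS.prop.2.insert fun y hy _ => ⟨h y hy, ?_⟩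
    rw [dist_comm]
    exact h y hy
  have := hS.le_of_ge hsep (Set.subset_insert x S) (Set.mem_insert x S)
  have := h x this
  rw [dist_self] at this
  linarith

/-- By maximality the `δ`-balls about the net cover the unit ball; compare volumes. -/
theorem IsMaximalNet.one_le_card_mul {d : ℕ} {δ : ℝ} (hδ : 0 < δ) {Ξ : Finset (Space d)}
    (hΞ : IsMaximalNet d δ (Ξ : Set (Space d))) : 1 ≤ (Ξ.card : ℝ) * δ ^ d := by
  have hsub : Metric.ball (0 : Space d) 1 ⊆ ⋃ ω ∈ Ξ, Metric.ball ω δ := by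
    intro x hx
    rw [mem_ball_zero_iff] at hx
    have hxc : x ∈ cube d := fun i => by
      have := (PiLp.norm_apply_le x i).trans hx.le
      exact abs_le.1 this
    obtain ⟨ω, hω, hlt⟩ := hΞ.exists_dist_lt hδ hxc
    exact Set.mem_biUnion (Finset.mem_coe.1 hω) hlt
  have h1 : 1 * volume (Metric.ball (0 : Space d) 1) ≤
      (Ξ.card : ℝ≥0∞) * ENNReal.ofReal (δ ^ d) * volume (Metric.ball (0 : Space d) 1) := by
    rw [one_mul]
    refine (measure_mono hsub).trans ((measure_biUnion_finset_le _ _).trans_eq ?_)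
    simp only [Measure.addHaar_ball_of_pos _ _ hδ, finrank_euclideanSpace, Fintype.card_fin,
      Finset.sum_const, nsmul_eq_mul, mul_assoc]
  have h2 := (ENNReal.mul_le_mul_iff_left (Metric.measure_ball_pos _ _ zero_lt_one).ne'
    measure_ball_lt_top.ne).1 h1
  rw [← ENNReal.ofReal_natCast, ← ENNReal.ofReal_mul (by positivity), ENNReal.one_le_ofReal] at h2
  exact h2

theorem IsSeparatedIn.card_mul_le {d : ℕ} {δ : ℝ} (hδ : 0 < δ) (hδ1 : δ < 1)
    {Ξ : Finset (Space d)} (hΞ : IsSeparatedIn d δ (Ξ : Set (Space d))) :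
    (Ξ.card : ℝ) * δ ^ d ≤ (2 * √d + 1) ^ d := by
  have h := card_le_of_separated_of_dist_le Ξ hδ (R := √d) (by positivity) 0 (fun c hc => by
    rw [dist_zero_right, ← mul_one √d]
    exact norm_le_of_abs_le zero_le_one fun i => abs_le.2 (hΞ.1 hc i)) hΞ.2
  rw [finrank_euclideanSpace, Fintype.card_fin] at h
  calc (Ξ.card : ℝ) * δ ^ d ≤ (2 * √d / δ + 1) ^ d * δ ^ d := by gcongr
    _ = (2 * √d + δ) ^ d := by rw [← mul_pow]; congr 1; field_simp
    _ ≤ _ := by gcongr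

/-! ### Test frequencies -/

/-- A small parallelepiped around the point of the paraboloid above `ξ`. -/
def box (d : ℕ) (ε δ : ℝ) (ξ : Space d) : Set (SpaceTime d) :=
  {p | (∀ i, |p.fst i - ξ i| ≤ ε * δ) ∧
    |p.snd - ‖ξ‖ ^ 2 - 2 * inner ℝ ξ (p.fst - ξ)| ≤ ε * δ ^ 2}

theorem center_mem_box {d : ℕ} {ε δ : ℝ} (hε : 0 < ε) (hδ : 0 < δ) (ξ : Space d) :
    (WithLp.toLp 2 (ξ, ‖ξ‖ ^ 2) : SpaceTime d) ∈ box d ε δ ξ := by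
  refine ⟨fun i => ?_, ?_⟩
  · simpa using (by positivity : 0 ≤ ε * δ)
  · simpa using (by positivity : 0 ≤ ε * δ ^ 2)

/-- The tangent planes of the paraboloid at `ξ` and `ω` differ by a difference of squares, as `h4`
records. The three terms are at most `dδ²/4`, `dδ²/4` and `dδ²` in absolute value, within the
allowed `2dδ²`. -/
theorem box_subset_tau {d : ℕ} (hd : 1 ≤ d) {ε δ : ℝ} (hε : 0 < ε) (hε' : ε ≤ 1 / 4)
    (hδ : 0 < δ) {ξ ω : Space d} (h : ∀ i, |ξ i - ω i| ≤ δ - ε * δ) :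
    box d ε δ ξ ⊆ tau d δ ω := by
  intro p hp
  have h1 : ∀ i, |p.fst i - ω i| ≤ δ := fun i => by
    have := abs_sub_le (p.fst i) (ξ i) (ω i)
    linarith [h i, hp.1 i]
  refine ⟨h1, ?_⟩
  have h2 : ‖p.fst - ω‖ ^ 2 ≤ d * δ ^ 2 := norm_sq_le_of_abs_le h1
  have h3 : ‖p.fst - ξ‖ ^ 2 ≤ d * (ε * δ) ^ 2 := norm_sq_le_of_abs_le hp.1
  have h4 : p.snd - 2 * inner ℝ ω (p.fst - ω) - ‖ω‖ ^ 2 =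
      (p.snd - ‖ξ‖ ^ 2 - 2 * inner ℝ ξ (p.fst - ξ)) - ‖p.fst - ξ‖ ^ 2 + ‖p.fst - ω‖ ^ 2 := by
    rw [norm_sub_sq_real, norm_sub_sq_real, inner_sub_right, inner_sub_right,
      real_inner_self_eq_norm_sq, real_inner_self_eq_norm_sq, real_inner_comm p.fst,
      real_inner_comm p.fst]
    ring
  rw [h4]
  have hd' : (1 : ℝ) ≤ d := by exact_mod_cast hd
  have h5 : ε * δ ^ 2 ≤ (1 / 4) * (d * δ ^ 2) := by
    have : ε * δ ^ 2 ≤ (1 / 4) * δ ^ 2 := by gcongr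
    nlinarith [sq_nonneg δ]
  have h6 : d * (ε * δ) ^ 2 ≤ (1 / 4) * (d * δ ^ 2) := by
    have : ε ^ 2 ≤ 1 / 4 := by nlinarith
    have : ε ^ 2 * (d * δ ^ 2) ≤ (1 / 4) * (d * δ ^ 2) := by gcongr
    linarith [this]
  have h7 := abs_le.1 hp.2
  have : 0 ≤ d * δ ^ 2 := by positivity
  exact abs_le.2 ⟨by nlinarith [sq_nonneg ‖p.fst - ω‖], by nlinarith [sq_nonneg ‖p.fst - ξ‖]⟩

theorem disjoint_box_tau {d : ℕ} {ε δ : ℝ} {ξ ω : Space d} {i : Fin d}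
    (h : δ + ε * δ < |ξ i - ω i|) : Disjoint (box d ε δ ξ) (tau d δ ω) := by
  rw [Set.disjoint_left]
  intro p hp hp'
  have h1 := abs_sub_le (ξ i) (p.fst i) (ω i)
  rw [abs_sub_comm (ξ i) (p.fst i)] at h1
  linarith [hp.1 i, hp'.1 i]

open scoped Classical in
/-- One can choose a frequency close to each point of a separated set in such a way that no small
box around a chosen frequency is cut by the boundary of one of the parallelepipeds. -/
theorem exists_frequencies (d : ℕ) (hd : 1 ≤ d) :
    ∃ n : ℕ, ∃ ε : ℝ, 0 < ε ∧ ∀ δ : ℝ, 0 < δ → δ < 1 → ∀ Ξ : Finset (Space d),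
      IsSeparatedIn d δ (Ξ : Set (Space d)) → ∃ ξ : Space d → Space d, ∀ ω ∈ Ξ,
        ‖ξ ω‖ ≤ 2 * √d ∧ box d ε δ (ξ ω) ⊆ tau d δ ω ∧
        (∀ ω' ∈ Ξ, box d ε δ (ξ ω) ⊆ tau d δ ω' ∨ Disjoint (box d ε δ (ξ ω)) (tau d δ ω')) ∧
        ({ω' ∈ Ξ | box d ε δ (ξ ω) ⊆ tau d δ ω'} : Finset _).card ≤ n ∧
        ({ω' ∈ Ξ | box d ε δ (ξ ω') ⊆ tau d δ ω} : Finset _).card ≤ n := by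
  obtain ⟨n, hn⟩ := exists_nat_ge ((4 * √d + 1) ^ d)
  -- Each coordinate has at most `2n` forbidden values, so `exists_far_from_finset` leaves a gap `δ
  -- / (2(2n + 1))`, which equals `2εδ`.
  set ε : ℝ := 1 / (4 * (2 * n + 1)) with hεdef
  have hε : 0 < ε := by positivity
  have hε' : ε ≤ 1 / 4 := by
    rw [hεdef]
    gcongr
    linarith [show (0 : ℝ) ≤ n by positivity]
  refine ⟨n, ε, hε, fun δ hδ hδ1 Ξ hΞ => ?_⟩
  let nb : Space d → Finset (Space d) := fun ω => {ω' ∈ Ξ | ∀ i, |ω' i - ω i| ≤ 2 * δ}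
  have hnb : ∀ ω, (nb ω).card ≤ n := fun ω => by
    have h := card_le_of_separated_of_dist_le (nb ω) hδ (R := √d * (2 * δ)) (by positivity) ω
      (fun c hc => by
        rw [dist_eq_norm]
        exact norm_le_of_abs_le (by positivity) (Finset.mem_filter.1 hc).2)
      (hΞ.2.mono fun c hc => (Finset.mem_filter.1 hc).1)
    rw [finrank_euclideanSpace, Fintype.card_fin,
      show 2 * (√d * (2 * δ)) / δ = 4 * √d by field_simp; norm_num] at h
    exact_mod_cast h.trans hn
  -- The forbidden values are the coordinates of the lateral faces of the neighbouring `τ_ω'`.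
  let P : Space d → Fin d → Finset ℝ := fun ω i =>
    (nb ω).image (fun ω' => ω' i + δ) ∪ (nb ω).image (fun ω' => ω' i - δ)
  have hP : ∀ ω i, (P ω i).card ≤ 2 * n := fun ω i => by
    refine (Finset.card_union_le _ _).trans ?_
    rw [two_mul]
    exact add_le_add (Finset.card_image_le.trans (hnb ω)) (Finset.card_image_le.trans (hnb ω))
  choose ζ hζ hζP using fun ω i => exists_far_from_finset (P ω i) (ω i - δ / 2) hδ (hP ω i)
  have hgap : δ / (2 * (((2 * n : ℕ) : ℝ) + 1)) = 2 * (ε * δ) := by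
    rw [hεdef]; push_cast; field_simp; norm_num
  refine ⟨fun ω => WithLp.toLp 2 (ζ ω), ?_⟩
  have hclose : ∀ ω i, |ζ ω i - ω i| ≤ δ / 2 := fun ω i =>
    abs_le.2 ⟨by linarith [(hζ ω i).1], by linarith [(hζ ω i).2]⟩
  have hεδ : ε * δ ≤ 1 / 4 * δ := by gcongr
  have hεδ0 : 0 < ε * δ := by positivity
  have hnear : ∀ ω ω', box d ε δ (WithLp.toLp 2 (ζ ω)) ⊆ tau d δ ω' →
      ∀ i, |ω' i - ω i| ≤ 2 * δ := fun ω ω' h i => by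
    have h1 := (h (center_mem_box hε hδ _)).1 i
    have h2 := abs_sub_le (ω' i) (ζ ω i) (ω i)
    change |ζ ω i - ω' i| ≤ δ at h1
    rw [abs_sub_comm (ω' i) (ζ ω i)] at h2
    linarith [hclose ω i]
  intro ω hω
  refine ⟨?_, ?_, fun ω' hω' => ?_, ?_, ?_⟩
  · have := norm_le_of_abs_le (x := WithLp.toLp 2 (ζ ω)) (b := 2) (by norm_num) (fun i => by
      have h1 := abs_sub_abs_le_abs_sub (ζ ω i) (ω i)
      have h2 := abs_le.2 (hΞ.1 hω i)
      have h3 := hclose ω i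
      simp only
      linarith)
    linarith
  · exact box_subset_tau hd hε hε' hδ fun i => by linarith [hclose ω i]
  · by_cases hfar : ∀ i, |ω' i - ω i| ≤ 2 * δ
    · have hmem : ω' ∈ nb ω := Finset.mem_filter.2 ⟨hω', hfar⟩
      have hp : ∀ i, 2 * (ε * δ) ≤ |ζ ω i - (ω' i + δ)| := fun i => hgap ▸ hζP ω i _
        (Finset.mem_union_left _ (Finset.mem_image_of_mem (fun ω' : Space d => ω' i + δ) hmem))
      have hm : ∀ i, 2 * (ε * δ) ≤ |ζ ω i - (ω' i - δ)| := fun i => hgap ▸ hζP ω i _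
        (Finset.mem_union_right _ (Finset.mem_image_of_mem (fun ω' : Space d => ω' i - δ) hmem))
      -- The gap around the faces excludes `δ - εδ < |ζ ω i - ω' i| ≤ δ + εδ`, so a failure of
      -- containment in one coordinate already forces disjointness.
      by_cases hin : ∀ i, |ζ ω i - ω' i| ≤ δ - ε * δ
      · exact Or.inl (box_subset_tau hd hε hε' hδ hin)
      · push Not at hin
        obtain ⟨i, hi⟩ := hin
        refine Or.inr (disjoint_box_tau (i := i) ?_)
        simp only
        have h1 := hp i
        have h2 := hm i
        rw [lt_abs] at hi ⊢
        rw [le_abs] at h1 h2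
        rcases hi with hi | hi <;> rcases h1 with h1 | h1 <;> rcases h2 with h2 | h2 <;>
          first
          | exact Or.inl (by linarith)
          | exact Or.inr (by linarith)
    · push Not at hfar
      obtain ⟨i, hi⟩ := hfar
      refine Or.inr (disjoint_box_tau (i := i) ?_)
      have h2 := abs_sub_le (ω' i) (ζ ω i) (ω i)
      rw [abs_sub_comm (ω' i) (ζ ω i)] at h2
      simp only
      linarith [hclose ω i]
  · refine le_trans (Finset.card_le_card fun ω' h => ?_) (hnb ω)
    rw [Finset.mem_filter] at h ⊢
    exact ⟨h.1, hnear ω ω' h.2⟩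
  · refine le_trans (Finset.card_le_card fun ω' h => ?_) (hnb ω)
    rw [Finset.mem_filter] at h ⊢
    exact ⟨h.1, fun i => abs_sub_comm (ω i) (ω' i) ▸ hnear ω' ω h.2 i⟩

/-! ### Wave packets -/

/-- The linear map `(ζ, η) ↦ (α ζ, β η + a·ζ)`. -/
noncomputable def shear (d : ℕ) (α β : ℝ) (a : Space d) : SpaceTime d →L[ℝ] SpaceTime d :=
  ((WithLp.prodContinuousLinearEquiv 2 ℝ (Space d) ℝ).symm : Space d × ℝ →L[ℝ] SpaceTime d).comp
    ((α • WithLp.fstL 2 ℝ (Space d) ℝ).prod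
      (β • WithLp.sndL 2 ℝ (Space d) ℝ + (innerSL ℝ a).comp (WithLp.fstL 2 ℝ (Space d) ℝ)))

theorem shear_apply {d : ℕ} (α β : ℝ) (a : Space d) (p : SpaceTime d) :
    shear d α β a p = WithLp.toLp 2 (α • p.fst, β * p.snd + inner ℝ a p.fst) := rfl

theorem shear_shear {d : ℕ} {α β α' β' : ℝ} {a a' : Space d} (hα : α' * α = 1)
    (hβ : β' * β = 1) (ha : β' • a + α • a' = 0) (p : SpaceTime d) :
    shear d α' β' a' (shear d α β a p) = p := by
  have h : β' * inner ℝ a p.fst + α * inner ℝ a' p.fst = 0 := by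
    rw [← real_inner_smul_left, ← real_inner_smul_left, ← inner_add_left, ha, inner_zero_left]
  apply (WithLp.equiv 2 (Space d × ℝ)).injective
  refine Prod.ext ?_ ?_
  · change α' • α • p.fst = p.fst
    rw [smul_smul, hα, one_smul]
  · change β' * (β * p.snd + inner ℝ a p.fst) + inner ℝ a' (α • p.fst) = p.snd
    rw [real_inner_smul_right]
    linear_combination p.snd * hβ + h

/-- The parabolic rescaling `(ζ, η) ↦ (δ⁻¹ ζ, δ⁻² (η - 2 ξ·ζ))` on the frequency side. -/
noncomputable def rescale (d : ℕ) {δ : ℝ} (hδ : δ ≠ 0) (ξ : Space d) :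
    SpaceTime d ≃L[ℝ] SpaceTime d :=
  ContinuousLinearEquiv.equivOfInverse (shear d δ⁻¹ (δ ^ 2)⁻¹ ((-2 * (δ ^ 2)⁻¹) • ξ))
    (shear d δ (δ ^ 2) ((2 * δ) • ξ))
    (shear_shear (by field_simp) (by field_simp) (by
      rw [smul_smul, smul_smul, ← add_smul]; field_simp; norm_num))
    (shear_shear (by field_simp) (by field_simp) (by
      rw [smul_smul, smul_smul, ← add_smul]; field_simp; norm_num))

theorem rescale_apply {d : ℕ} {δ : ℝ} (hδ : δ ≠ 0) (ξ : Space d) (p : SpaceTime d) :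
    rescale d hδ ξ p =
      WithLp.toLp 2 (δ⁻¹ • p.fst, (δ ^ 2)⁻¹ * (p.snd - 2 * inner ℝ ξ p.fst)) := by
  change shear d _ _ _ p = _
  rw [shear_apply, real_inner_smul_left]
  congr 2
  ring

theorem integral_comp_continuousLinearEquiv {E F : Type*} [NormedAddCommGroup E]
    [NormedSpace ℝ E] [FiniteDimensional ℝ E] [MeasurableSpace E] [BorelSpace E]
    [NormedAddCommGroup F] [NormedSpace ℝ F] (μ : Measure E) [μ.IsAddHaarMeasure]
    (B : E ≃L[ℝ] E) (f : E → F) :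
    |LinearMap.det (B.toLinearEquiv : E →ₗ[ℝ] E)| • ∫ x, f (B x) ∂μ = ∫ x, f x ∂μ := by
  have h0 : LinearMap.det (B.toLinearEquiv : E →ₗ[ℝ] E) ≠ 0 :=
    (LinearEquiv.isUnit_det' B.toLinearEquiv).ne_zero
  have h1 := Measure.map_linearMap_addHaar_eq_smul_addHaar μ h0
  have h2 := (B.toHomeomorph.measurableEmbedding).integral_map (μ := μ) f
  change Measure.map B μ = _ at h1
  change ∫ y, f y ∂Measure.map B μ = ∫ x, f (B x) ∂μ at h2
  rw [← h2, h1, integral_smul_measure, ENNReal.toReal_ofReal (abs_nonneg _), smul_smul, abs_inv,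
    mul_inv_cancel₀ (abs_ne_zero.2 h0), one_smul]

/-- The wave packet with profile `φ`, frequency `ξ` and scale `δ`, centred at the origin. -/
noncomputable def packet {d : ℕ} (φ : SpaceTime d → ℂ) (δ : ℝ) (ξ : Space d)
    (p : SpaceTime d) : ℂ :=
  (Real.fourierChar (inner ℝ ξ p.fst + ‖ξ‖ ^ 2 * p.snd) : ℂ) *
    φ (WithLp.toLp 2 (δ • (p.fst + (2 * p.snd) • ξ), δ ^ 2 * p.snd))

/-- The Fourier transform of a translate of a wave packet. -/
noncomputable def packetHat {d : ℕ} (h : SpaceTime d → ℝ) {δ : ℝ} (hδ : δ ≠ 0) (ξ : Space d)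
    (z ζ : SpaceTime d) : ℂ :=
  (Real.fourierChar (-inner ℝ ζ z) : ℂ) *
    ((|LinearMap.det ((rescale d hδ ξ).toLinearEquiv : SpaceTime d →ₗ[ℝ] SpaceTime d)| *
      h (rescale d hδ ξ (ζ - WithLp.toLp 2 (ξ, ‖ξ‖ ^ 2))) : ℝ) : ℂ)

/-- Translation by the point of the paraboloid produces the modulation, the linear change of
variables produces the rescaled argument of the profile, and the determinant keeps the amplitude
independent of `δ`. -/
theorem fourierInv_packetHat {d : ℕ} (h : SpaceTime d → ℝ) {δ : ℝ} (hδ : δ ≠ 0) (ξ : Space d)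
    (z w : SpaceTime d) :
    𝓕⁻ (packetHat h hδ ξ z) w = packet (𝓕⁻ fun p => (h p : ℂ)) δ ξ (w - z) := by
  set B := rescale d hδ ξ with hB
  set D := |LinearMap.det (B.toLinearEquiv : SpaceTime d →ₗ[ℝ] SpaceTime d)| with hD
  rw [Real.fourierInv_eq, packet, Real.fourierInv_eq]
  rw [← integral_add_right_eq_self _ (WithLp.toLp 2 (ξ, ‖ξ‖ ^ 2) : SpaceTime d),
    ← integral_comp_continuousLinearEquiv volume B (fun v => Real.fourierChar
      (inner ℝ v (WithLp.toLp 2 (δ • ((w - z).fst + (2 * (w - z).snd) • ξ),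
        δ ^ 2 * (w - z).snd) : SpaceTime d)) • (h v : ℂ)),
    ← integral_smul, ← integral_const_mul]
  refine integral_congr_ae (Filter.Eventually.of_forall fun ζ => ?_)
  -- The argument of the profile in `packet` is the inverse adjoint of `rescale` applied to `w - z`.
  have hinner : inner ℝ (B ζ) (WithLp.toLp 2 (δ • ((w - z).fst + (2 * (w - z).snd) • ξ),
      δ ^ 2 * (w - z).snd) : SpaceTime d) = inner ℝ ζ (w - z) := by
    rw [hB, rescale_apply, WithLp.prod_inner_apply, WithLp.prod_inner_apply]
    simp only [inner_smul_left, inner_smul_right, inner_add_right, real_inner_comm ξ,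
      RCLike.inner_apply, conj_trivial]
    field_simp
    change _ = inner ℝ ζ.fst (w - z).fst + (w - z).snd * ζ.snd
    ring
  simp only [packetHat, Circle.smul_def, smul_eq_mul, add_sub_cancel_right, hinner]
  have hchar : Real.fourierChar (inner ℝ (ζ + WithLp.toLp 2 (ξ, ‖ξ‖ ^ 2)) w) *
      Real.fourierChar (-inner ℝ (ζ + WithLp.toLp 2 (ξ, ‖ξ‖ ^ 2)) z) =
      Real.fourierChar (inner ℝ ξ (w - z).fst + ‖ξ‖ ^ 2 * (w - z).snd) *
        Real.fourierChar (inner ℝ ζ (w - z)) := by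
    rw [← AddChar.map_add_eq_mul, ← AddChar.map_add_eq_mul]
    congr 1
    rw [← sub_eq_add_neg, ← inner_sub_right, inner_add_left, WithLp.prod_inner_apply _ (w - z),
      WithLp.prod_inner_apply _ (w - z)]
    simp only [RCLike.inner_apply, conj_trivial]
    change _ + (inner ℝ ξ (w - z).fst + (w - z).snd * ‖ξ‖ ^ 2) = _
    ring
  have hchar' := congrArg (fun c : Circle => (c : ℂ)) hchar
  simp only [Circle.coe_mul] at hchar'
  rw [← mul_assoc, hchar', Complex.ofReal_mul, Complex.real_smul]
  ring

theorem contDiff_packetHat {d : ℕ} {h : SpaceTime d → ℝ} (hh : ContDiff ℝ (⊤ : ℕ∞) h) {δ : ℝ}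
    (hδ : δ ≠ 0) (ξ : Space d) (z : SpaceTime d) :
    ContDiff ℝ (⊤ : ℕ∞) (packetHat h hδ ξ z) := by
  unfold packetHat
  simp only [Real.fourierChar_apply]
  refine ContDiff.mul ?_ ?_
  · refine Complex.contDiff_exp.comp (ContDiff.mul ?_ contDiff_const)
    refine Complex.ofRealCLM.contDiff.comp (contDiff_const.mul ?_)
    exact (contDiff_id.inner ℝ contDiff_const).neg
  · refine Complex.ofRealCLM.contDiff.comp (contDiff_const.mul ?_)
    exact hh.comp ((rescale d hδ ξ).contDiff.comp (contDiff_id.sub contDiff_const))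

theorem hasCompactSupport_packetHat {d : ℕ} {h : SpaceTime d → ℝ} (hh : HasCompactSupport h)
    {δ : ℝ} (hδ : δ ≠ 0) (ξ : Space d) (z : SpaceTime d) :
    HasCompactSupport (packetHat h hδ ξ z) := by
  have h1 : HasCompactSupport fun ζ => h (rescale d hδ ξ (ζ - WithLp.toLp 2 (ξ, ‖ξ‖ ^ 2))) :=
    hh.comp_homeomorph ((Homeomorph.subRight _).trans (rescale d hδ ξ).toHomeomorph)
  refine h1.mono fun ζ hζ => ?_
  contrapose! hζ
  simp only [Function.mem_support, not_not] at hζ ⊢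
  simp only [packetHat, hζ, mul_zero, Complex.ofReal_zero]

theorem support_packetHat_subset {d : ℕ} {h : SpaceTime d → ℝ} {ε : ℝ}
    (hh : ∀ p, h p ≠ 0 → ‖p‖ ≤ ε) {δ : ℝ} (hδ : 0 < δ) (ξ : Space d) (z : SpaceTime d) :
    Function.support (packetHat h hδ.ne' ξ z) ⊆ box d ε δ ξ := by
  intro ζ hζ
  have h1 : h (rescale d hδ.ne' ξ (ζ - WithLp.toLp 2 (ξ, ‖ξ‖ ^ 2))) ≠ 0 := by
    intro h0
    exact hζ (by simp only [packetHat, h0, mul_zero, Complex.ofReal_zero])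
  have h2 := hh _ h1
  rw [rescale_apply] at h2
  have h3 := (WithLp.norm_fst_le _ _).trans h2
  have h4 := (WithLp.norm_snd_le _ _).trans h2
  refine ⟨fun i => ?_, ?_⟩
  · have h5 := (PiLp.norm_apply_le _ i).trans h3
    simp only [WithLp.toLp_fst, WithLp.sub_fst, PiLp.smul_apply, PiLp.sub_apply, smul_eq_mul,
      Real.norm_eq_abs, abs_mul, abs_inv, abs_of_pos hδ] at h5
    rwa [inv_mul_le_iff₀ hδ, mul_comm δ] at h5
  · simp only [WithLp.toLp_snd, WithLp.sub_snd, WithLp.sub_fst, WithLp.toLp_fst,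
      Real.norm_eq_abs, abs_mul, abs_inv, abs_pow, abs_of_pos hδ] at h4
    rwa [inv_mul_le_iff₀ (by positivity), mul_comm (δ ^ 2)] at h4

/-- The normalisation of the integral makes the inverse Fourier transform equal to `1` at the
origin. -/
theorem exists_profile (d : ℕ) {ε : ℝ} (hε : 0 < ε) :
    ∃ h : SpaceTime d → ℝ, ContDiff ℝ (⊤ : ℕ∞) h ∧ HasCompactSupport h ∧
      (∀ p, h p ≠ 0 → ‖p‖ ≤ ε) ∧ ∫ p, h p = 1 := by
  let f : ContDiffBump (0 : SpaceTime d) := ⟨ε / 2, ε, by linarith, by linarith⟩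
  refine ⟨f.normed volume, f.contDiff_normed, f.hasCompactSupport_normed, fun p hp => ?_,
    f.integral_normed⟩
  have : p ∈ Function.support (f.normed volume) := hp
  rw [f.support_normed_eq, mem_ball_zero_iff] at this
  exact this.le

/-- A sum of wave packets, as a Schwartz function whose Fourier projections are known. -/
theorem exists_schwartz_proj_eq {d : ℕ} {h : SpaceTime d → ℝ} (hh : ContDiff ℝ (⊤ : ℕ∞) h)
    (hc : HasCompactSupport h) {ε : ℝ} (hε : ∀ p, h p ≠ 0 → ‖p‖ ≤ ε) {δ : ℝ} (hδ : 0 < δ)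
    {ι : Type*} (I : Finset ι) (ξ : ι → Space d) (z : ι → SpaceTime d) :
    ∃ f : 𝓢(SpaceTime d, ℂ),
      Function.support (𝓕 (f : SpaceTime d → ℂ)) ⊆ ⋃ k ∈ I, box d ε δ (ξ k) ∧
      ∀ τ : Set (SpaceTime d), ∀ J ⊆ I, (∀ k ∈ J, box d ε δ (ξ k) ⊆ τ) →
        (∀ k ∈ I, k ∉ J → Disjoint (box d ε δ (ξ k)) τ) →
        ∀ w, proj τ f w = ∑ k ∈ J, packet (𝓕⁻ fun p => (h p : ℂ)) δ (ξ k) (w - z k) := by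
  let H : ι → 𝓢(SpaceTime d, ℂ) := fun k =>
    (hasCompactSupport_packetHat hc hδ.ne' (ξ k) (z k)).toSchwartzMap
      (contDiff_packetHat hh hδ.ne' (ξ k) (z k))
  have hH : ∀ k p, H k p = packetHat h hδ.ne' (ξ k) (z k) p := fun k p => rfl
  have hsupp : ∀ k p, p ∉ box d ε δ (ξ k) → H k p = 0 := fun k p hp => by
    by_contra h0
    exact hp (support_packetHat_subset hε hδ (ξ k) (z k) h0)
  have hF : 𝓕 ((𝓕⁻ (∑ k ∈ I, H k) : 𝓢(SpaceTime d, ℂ)) : SpaceTime d → ℂ) =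
      (∑ k ∈ I, H k : 𝓢(SpaceTime d, ℂ)) := by
    rw [← SchwartzMap.fourier_coe, FourierTransform.fourier_fourierInv_eq]
  refine ⟨𝓕⁻ (∑ k ∈ I, H k), ?_, fun τ J hJ hJτ hIτ w => ?_⟩
  · rw [hF]
    intro p hp
    contrapose! hp
    simp only [Set.mem_iUnion, not_exists] at hp
    rw [Function.mem_support, not_not, sum_apply]
    exact Finset.sum_eq_zero fun k hk => hsupp k p (hp k hk)
  -- Since every box is inside `τ` or disjoint from it, the sharp cutoff merely selects the terms in
  -- `J`.
  · have hind : τ.indicator (𝓕 ((𝓕⁻ (∑ k ∈ I, H k) : 𝓢(SpaceTime d, ℂ)) : SpaceTime d → ℂ)) =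
        (∑ k ∈ J, H k : 𝓢(SpaceTime d, ℂ)) := by
      rw [hF]
      ext p
      rw [sum_apply]
      by_cases hp : p ∈ τ
      · rw [Set.indicator_of_mem hp, sum_apply]
        refine (Finset.sum_subset hJ fun k hk hkJ => hsupp k p fun hpb => ?_).symm
        exact Set.disjoint_left.1 (hIτ k hk hkJ) hpb hp
      · rw [Set.indicator_of_notMem hp]
        exact (Finset.sum_eq_zero fun k hk => hsupp k p fun hpb => hp (hJτ k hk hpb)).symm
    rw [proj, hind, ← SchwartzMap.fourierInv_coe, FourierTransform.fourierInv_sum,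
      sum_apply]
    refine Finset.sum_congr rfl fun k _ => ?_
    rw [← fourierInv_packetHat h hδ.ne' (ξ k) (z k) w, SchwartzMap.fourierInv_coe]
    rfl

/-- A wave packet profile with its quantitative properties, together with the superpositions of
wave packets whose projections to the parallelepipeds of a separated set are again such
superpositions. -/
structure PacketFamily (d : ℕ) where
  φ : SpaceTime d → ℂ
  n : ℕ
  C : ℝ
  ρ : ℝ
  I : ℝ
  J : ℝ
  n_pos : 0 < n
  C_pos : 0 < C
  ρ_pos : 0 < ρ
  ρ_le_one : ρ ≤ 1
  I_pos : 0 < I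
  J_pos : 0 < J
  norm_packet_le : ∀ δ ξ x t, ‖packet φ δ ξ (WithLp.toLp 2 (x, t))‖ ≤
    C * (decay (d + 1) (δ • (x + (2 * t) • ξ)) * decay 2 (δ ^ 2 * t))
  -- This bound includes the phase and holds on a region independent of `δ` and `ξ`, which makes
  -- different frequencies add coherently. The next field controls only the modulus, but on the
  -- whole tube.
  half_le_re : ∀ δ ξ x t, 0 < δ → δ < 1 → ‖ξ‖ ≤ 2 * √d → ‖x‖ ≤ ρ → |t| ≤ ρ →
    1 / 2 ≤ (packet φ δ ξ (WithLp.toLp 2 (x, t))).re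
  half_le_norm : ∀ δ ξ x t, ‖δ • (x + (2 * t) • ξ)‖ ≤ ρ → |δ ^ 2 * t| ≤ ρ →
    1 / 2 ≤ ‖packet φ δ ξ (WithLp.toLp 2 (x, t))‖
  lintegral_space_le : ∀ δ, 0 < δ → ∀ a : Space d,
    ∫⁻ x, ENNReal.ofReal (decay (d + 1) (δ • (x - a))) ≤ ENNReal.ofReal ((δ ^ d)⁻¹ * I)
  lintegral_time_le : ∀ c, 0 < c → ∀ a : ℝ,
    ∫⁻ t, ENNReal.ofReal (decay 2 (c * (t - a))) ≤ ENNReal.ofReal (c⁻¹ * J)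
  exists_schwartz : ∀ δ, 0 < δ → δ < 1 → ∀ Ξ : Finset (Space d),
    IsSeparatedIn d δ (Ξ : Set (Space d)) →
    ∃ (ξ : Space d → Space d) (nb : Space d → Finset (Space d)) (m : Space d → ℕ),
      (∀ ω ∈ Ξ, ‖ξ ω‖ ≤ 2 * √d ∧ (nb ω).card ≤ n ∧ nb ω ⊆ Ξ ∧ 1 ≤ m ω ∧ m ω ≤ n) ∧
      ∀ (M : ℕ) (z : Space d → ℕ → SpaceTime d), ∃ f : 𝓢(SpaceTime d, ℂ),
        Function.support (𝓕 (f : SpaceTime d → ℂ)) ⊆ ⋃ ω ∈ Ξ, tau d δ ω ∧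
        (∀ ω ∈ Ξ, ∀ w, proj (tau d δ ω) f w =
          ∑ ω' ∈ nb ω, ∑ j ∈ Finset.range M, packet φ δ (ξ ω') (w - z ω' j)) ∧
        ∀ w, (∑ ω ∈ Ξ, proj (tau d δ ω) f) w =
          ∑ ω ∈ Ξ, (m ω : ℂ) * ∑ j ∈ Finset.range M, packet φ δ (ξ ω) (w - z ω j)

/-! ### Constants of the profile and existence of a packet family. -/

theorem exists_lintegral_decay_smul_sub_le {E : Type*} [NormedAddCommGroup E] [NormedSpace ℝ E]
    [FiniteDimensional ℝ E] [MeasurableSpace E] [BorelSpace E] (μ : Measure E)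
    [μ.IsAddHaarMeasure] {k : ℕ} (hk : Module.finrank ℝ E < k) :
    ∃ I : ℝ, 0 < I ∧ ∀ c : ℝ, 0 < c → ∀ a : E, ∫⁻ u, ENNReal.ofReal (decay k (c • (u - a))) ∂μ ≤
      ENNReal.ofReal ((c ^ Module.finrank ℝ E)⁻¹ * I) := by
  refine ⟨(∫⁻ u, ENNReal.ofReal (decay k u) ∂μ).toReal + 1, by positivity, fun c hc a => ?_⟩
  rw [lintegral_decay_smul_sub k μ hc a, ENNReal.ofReal_mul (by positivity)]
  gcongr
  refine (ENNReal.ofReal_toReal (lintegral_decay_lt_top hk μ).ne).symm.trans_le ?_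
  exact ENNReal.ofReal_le_ofReal (by linarith)

theorem exists_norm_le_decay {d : ℕ} (g : 𝓢(SpaceTime d, ℂ)) (k l : ℕ) :
    ∃ C : ℝ, 0 < C ∧ ∀ (x : Space d) (t : ℝ),
      ‖g (WithLp.toLp 2 (x, t))‖ ≤ C * (decay k x * decay l t) := by
  set S := 2 ^ (k + l) * ((Finset.Iic (k + l, 0)).sup
    fun m => SchwartzMap.seminorm ℝ m.1 m.2) g with hS
  have hS0 : 0 ≤ S := by positivity
  refine ⟨S + 1, by linarith, fun x t => ?_⟩
  have h := SchwartzMap.one_add_le_sup_seminorm_apply (𝕜 := ℝ) (m := (k + l, 0)) (k := k + l)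
    (n := 0) le_rfl le_rfl g (WithLp.toLp 2 (x, t))
  rw [norm_iteratedFDeriv_zero] at h
  have hx : ‖x‖ ≤ ‖(WithLp.toLp 2 (x, t) : SpaceTime d)‖ :=
    WithLp.norm_fst_le _ (WithLp.toLp 2 (x, t) : SpaceTime d)
  have ht : ‖t‖ ≤ ‖(WithLp.toLp 2 (x, t) : SpaceTime d)‖ :=
    WithLp.norm_snd_le _ (WithLp.toLp 2 (x, t) : SpaceTime d)
  unfold decay
  rw [← mul_inv, ← div_eq_mul_inv, le_div_iff₀ (by positivity)]
  calc ‖g (WithLp.toLp 2 (x, t))‖ * ((1 + ‖x‖) ^ k * (1 + ‖t‖) ^ l)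
      ≤ ‖g (WithLp.toLp 2 (x, t))‖ * ((1 + ‖(WithLp.toLp 2 (x, t) : SpaceTime d)‖) ^ k *
        (1 + ‖(WithLp.toLp 2 (x, t) : SpaceTime d)‖) ^ l) := by gcongr
    _ = (1 + ‖(WithLp.toLp 2 (x, t) : SpaceTime d)‖) ^ (k + l) *
        ‖g (WithLp.toLp 2 (x, t))‖ := by rw [pow_add]; ring
    _ ≤ S := h
    _ ≤ S + 1 := by linarith

theorem exists_half_le_re {d : ℕ} {φ : SpaceTime d → ℂ} (hφ : Continuous φ) (h0 : φ 0 = 1) :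
    ∃ ρ : ℝ, 0 < ρ ∧ ρ ≤ 1 ∧ ∀ (s : ℝ) (x : Space d) (t : ℝ), |s| ≤ ρ → ‖x‖ ≤ ρ → |t| ≤ ρ →
      1 / 2 ≤ ((Real.fourierChar s : ℂ) * φ (WithLp.toLp 2 (x, t))).re := by
  let G : ℝ × Space d × ℝ → ℝ := fun p =>
    ((Real.fourierChar p.1 : ℂ) * φ (WithLp.toLp 2 (p.2.1, p.2.2))).re
  have hG : Continuous G := by
    have h1 : Continuous fun p : ℝ × Space d × ℝ => (Real.fourierChar p.1 : ℂ) :=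
      continuous_subtype_val.comp (Real.continuous_fourierChar.comp continuous_fst)
    have h2 : Continuous fun p : ℝ × Space d × ℝ =>
        φ (WithLp.toLp 2 (p.2.1, p.2.2) : SpaceTime d) :=
      hφ.comp ((WithLp.prod_continuous_toLp 2 _ _).comp continuous_snd)
    exact Complex.continuous_re.comp (h1.mul h2)
  have hG0 : G 0 = 1 := by
    simp [G, h0]
  obtain ⟨ρ, hρ, hball⟩ := Metric.continuousAt_iff.1
    (hG.continuousAt (x := (0 : ℝ × Space d × ℝ))) (1 / 2) (by norm_num)
  refine ⟨min (ρ / 2) 1, by positivity, min_le_right _ _, fun s x t hs hx ht => ?_⟩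
  have hlt : min (ρ / 2) 1 < ρ := (min_le_left _ _).trans_lt (by linarith)
  have h1 := @hball (s, x, t) (by
    rw [dist_zero_right, Prod.norm_def, Prod.norm_def]
    exact max_lt (hs.trans_lt hlt) (max_lt (hx.trans_lt hlt) (ht.trans_lt hlt)))
  rw [hG0, Real.dist_eq, abs_lt] at h1
  change 1 / 2 ≤ G (s, x, t)
  linarith [h1.1]

open scoped Classical in
theorem nonempty_packetFamily (d : ℕ) (hd : 1 ≤ d) : Nonempty (PacketFamily d) := by
  obtain ⟨n, ε, hε, hfreq⟩ := exists_frequencies d hd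
  obtain ⟨h, hsm, hcomp, hsupp, hint⟩ := exists_profile d hε
  let H : 𝓢(SpaceTime d, ℂ) := HasCompactSupport.toSchwartzMap (f := fun p => (h p : ℂ))
    (hcomp.comp_left Complex.ofReal_zero) (Complex.ofRealCLM.contDiff.comp hsm)
  have hH : ∀ p, (𝓕⁻ H : 𝓢(SpaceTime d, ℂ)) p = (𝓕⁻ fun p => (h p : ℂ)) p := fun p => by
    rw [SchwartzMap.fourierInv_coe]; rfl
  set φ : SpaceTime d → ℂ := 𝓕⁻ fun p => (h p : ℂ) with hφ
  have hcont : Continuous φ := by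
    have := (𝓕⁻ H : 𝓢(SpaceTime d, ℂ)).continuous
    exact this.congr hH
  have hφ0 : φ 0 = 1 := by
    rw [hφ, Real.fourierInv_eq]
    simp only [inner_zero_right, AddChar.map_zero_eq_one, one_smul]
    rw [integral_complex_ofReal, hint, Complex.ofReal_one]
  obtain ⟨C, hC, hCdec⟩ := exists_norm_le_decay (𝓕⁻ H : 𝓢(SpaceTime d, ℂ)) (d + 1) 2
  obtain ⟨ρ, hρ, hρ1, hre⟩ := exists_half_le_re hcont hφ0
  obtain ⟨I, hI, hIle⟩ := exists_lintegral_decay_smul_sub_le (volume : Measure (Space d))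
    (k := d + 1) (by simp)
  obtain ⟨J, hJ, hJle⟩ := exists_lintegral_decay_smul_sub_le (volume : Measure ℝ)
    (k := 2) (by simp)
  -- For `‖ξ‖ ≤ 2√d` and `‖x‖, |t| ≤ ρ₁`, the phase is at most `(2√d + 4d)ρ₁` and `‖x + 2tξ‖` at
  -- most `(1 + 4√d)ρ₁`; dividing `ρ` by this factor makes both at most `ρ`.
  have hK : 1 ≤ 1 + 4 * √d + 4 * d := by
    linarith [Real.sqrt_nonneg (d : ℝ), Nat.cast_nonneg (α := ℝ) d]
  have hρ' : ρ / (1 + 4 * √d + 4 * d) ≤ ρ := div_le_self hρ.le hK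
  refine ⟨⟨φ, n + 1, C, ρ / (1 + 4 * √d + 4 * d), I, J, n.succ_pos, hC, by positivity,
    hρ'.trans hρ1, hI, hJ, fun δ ξ x t => ?_, fun δ ξ x t hδ hδ1 hξ hx ht => ?_,
    fun δ ξ x t hx ht => ?_, fun δ hδ a => by simpa using hIle δ hδ a,
    fun c hc a => by simpa using hJle c hc a, fun δ hδ hδ1 Ξ hΞ => ?_⟩⟩
  · rw [packet, norm_mul, Circle.norm_coe, one_mul, ← hH]
    exact hCdec _ _
  · set ρ₁ := ρ / (1 + 4 * √d + 4 * d) with hρ₁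
    have hmul : ρ₁ * (1 + 4 * √d + 4 * d) = ρ := div_mul_cancel₀ _ (by linarith)
    have hρ₁0 : 0 < ρ₁ := by positivity
    have hs : 0 ≤ √(d : ℝ) := by positivity
    refine hre _ _ _ ?_ ?_ ?_
    · change |inner ℝ ξ x + ‖ξ‖ ^ 2 * t| ≤ ρ
      have h1 : |inner ℝ ξ x| ≤ 2 * √d * ρ₁ :=
        (abs_real_inner_le_norm ξ x).trans (by gcongr)
      have h2 : |‖ξ‖ ^ 2 * t| ≤ 4 * d * ρ₁ := by
        rw [abs_mul, abs_of_nonneg (by positivity)]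
        have : ‖ξ‖ ^ 2 ≤ 4 * (d : ℝ) := by
          calc ‖ξ‖ ^ 2 ≤ (2 * √(d : ℝ)) ^ 2 := by gcongr
            _ = 4 * (d : ℝ) := by rw [mul_pow, Real.sq_sqrt (by positivity)]; norm_num
        gcongr
      have h3 := abs_add_le (inner ℝ ξ x) (‖ξ‖ ^ 2 * t)
      nlinarith [mul_nonneg hs hρ₁0.le]
    · change ‖δ • (x + (2 * t) • ξ)‖ ≤ ρ
      rw [norm_smul, Real.norm_eq_abs, abs_of_pos hδ]
      have h1 : ‖(2 * t) • ξ‖ ≤ 2 * ρ₁ * (2 * √d) := by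
        rw [norm_smul, Real.norm_eq_abs, abs_mul, abs_two]
        gcongr
      have h2 := norm_add_le x ((2 * t) • ξ)
      have h3 : δ * ‖x + (2 * t) • ξ‖ ≤ 1 * ‖x + (2 * t) • ξ‖ := by gcongr
      have : 0 ≤ ρ₁ * (4 * d) := by positivity
      nlinarith
    · change |δ ^ 2 * t| ≤ ρ
      rw [abs_mul, abs_of_nonneg (by positivity)]
      have : δ ^ 2 * |t| ≤ 1 * |t| := by gcongr; exact pow_le_one₀ hδ.le hδ1.le
      linarith
  · rw [packet, norm_mul, Circle.norm_coe, one_mul]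
    have h1 := hre 0 (δ • (x + (2 * t) • ξ)) (δ ^ 2 * t) (by simpa using hρ.le)
      (hx.trans hρ') (ht.trans hρ')
    rw [AddChar.map_zero_eq_one, Circle.coe_one, one_mul] at h1
    exact h1.trans (Complex.re_le_norm _)
  · obtain ⟨ξ, hξ⟩ := hfreq δ hδ hδ1 Ξ hΞ
    let nb : Space d → Finset (Space d) := fun ω => {ω' ∈ Ξ | box d ε δ (ξ ω') ⊆ tau d δ ω}
    let m : Space d → ℕ := fun ω => ({ω' ∈ Ξ | box d ε δ (ξ ω) ⊆ tau d δ ω'} : Finset _).card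
    refine ⟨ξ, nb, m, fun ω hω => ⟨(hξ ω hω).1, (hξ ω hω).2.2.2.2.trans n.le_succ,
      Finset.filter_subset _ _, Finset.card_pos.2
        ⟨ω, Finset.mem_filter.2 ⟨hω, (hξ ω hω).2.1⟩⟩, (hξ ω hω).2.2.2.1.trans n.le_succ⟩,
      fun M z => ?_⟩
    obtain ⟨f, hf, hproj⟩ := exists_schwartz_proj_eq hsm hcomp hsupp hδ
      (Ξ ×ˢ Finset.range M) (fun k => ξ k.1) (fun k => z k.1 k.2)
    have hp : ∀ ω ∈ Ξ, ∀ w, proj (tau d δ ω) f w =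
        ∑ ω' ∈ nb ω, ∑ j ∈ Finset.range M, packet φ δ (ξ ω') (w - z ω' j) := by
      intro ω hω w
      rw [hproj (tau d δ ω) (nb ω ×ˢ Finset.range M)
        (Finset.product_subset_product_left (Finset.filter_subset _ _)) ?_ ?_ w,
        Finset.sum_product]
      · intro k hk
        exact (Finset.mem_filter.1 (Finset.mem_product.1 hk).1).2
      · intro k hk hk'
        rw [Finset.mem_product] at hk hk'
        refine ((hξ k.1 hk.1).2.2.1 ω hω).resolve_left fun hsub => hk' ?_
        exact ⟨Finset.mem_filter.2 ⟨hk.1, hsub⟩, hk.2⟩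
    refine ⟨f, hf.trans ?_, hp, fun w => ?_⟩
    · refine Set.iUnion₂_subset fun k hk => ?_
      have hk1 := (Finset.mem_product.1 hk).1
      exact (hξ k.1 hk1).2.1.trans (Set.subset_biUnion_of_mem (u := tau d δ)
        (Finset.mem_coe.2 hk1))
    · rw [Finset.sum_apply, Finset.sum_congr rfl fun ω hω => hp ω hω w]
      simp only [nb, Finset.sum_filter]
      -- Double counting: after the exchange, each packet is counted once for every `τ_ω'`
      -- containing its box, which is `m ω`.
      rw [Finset.sum_comm]
      refine Finset.sum_congr rfl fun ω hω => ?_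
      rw [← Finset.sum_filter, Finset.sum_const, nsmul_eq_mul]

/-! ### Upper bounds for superpositions of wave packets -/

/-- This replaces several nearby time centres by a single one at the cost of a constant. -/
theorem decay_two_le_four_mul {u v : ℝ} (h : |u - v| ≤ 1) : decay 2 u ≤ 4 * decay 2 v := by
  unfold decay
  have h1 : 1 + ‖v‖ ≤ 2 * (1 + ‖u‖) := by
    have := abs_sub_abs_le_abs_sub v u
    rw [abs_sub_comm] at this
    simp only [Real.norm_eq_abs]
    linarith [abs_nonneg u]
  rw [← div_eq_mul_inv, le_div_iff₀ (by positivity), inv_mul_le_iff₀ (by positivity)]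
  calc (1 + ‖v‖) ^ 2 ≤ (2 * (1 + ‖u‖)) ^ 2 := by gcongr
    _ = _ := by ring

theorem lintegral_ofReal_sum_le {α ι : Type*} [MeasurableSpace α] {μ : Measure α} (K : Finset ι)
    {c : ι → ℝ} (hc : ∀ k ∈ K, 0 ≤ c k) {D : ι → α → ℝ} (hD : ∀ k ∈ K, ∀ x, 0 ≤ D k x)
    (hm : ∀ k ∈ K, Measurable (D k)) {X : ℝ} (hX : 0 ≤ X)
    (h : ∀ k ∈ K, ∫⁻ x, ENNReal.ofReal (D k x) ∂μ ≤ ENNReal.ofReal X) :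
    ∫⁻ x, ENNReal.ofReal (∑ k ∈ K, c k * D k x) ∂μ ≤ ENNReal.ofReal ((∑ k ∈ K, c k) * X) := by
  have h1 : ∀ x, ENNReal.ofReal (∑ k ∈ K, c k * D k x) =
      ∑ k ∈ K, ENNReal.ofReal (c k) * ENNReal.ofReal (D k x) := fun x => by
    rw [ENNReal.ofReal_sum_of_nonneg fun k hk => mul_nonneg (hc k hk) (hD k hk x)]
    exact Finset.sum_congr rfl fun k hk => ENNReal.ofReal_mul (hc k hk)
  simp only [h1]
  rw [lintegral_finsetSum _ fun k hk => (hm k hk).ennreal_ofReal.const_mul _, Finset.sum_mul,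
    ENNReal.ofReal_sum_of_nonneg fun k hk => mul_nonneg (hc k hk) hX]
  refine Finset.sum_le_sum fun k hk => ?_
  rw [lintegral_const_mul' _ _ ENNReal.ofReal_ne_top, ENNReal.ofReal_mul (hc k hk)]
  gcongr
  exact h k hk

/-- Time centres within `δ⁻²` of `s₀ ω` share one time envelope, at the cost of a factor `4`.
Packets of equal frequency move in parallel, so their separation does not change with time and their
spatial weights sum to at most `2`. Hence `M` enters only through the spatial `L¹` norm, that is
with the power `1/r`. -/
theorem PacketFamily.mixedNorm_sum_packet_le {d : ℕ} (P : PacketFamily d) {q r : ℝ≥0∞}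
    (hq : 1 ≤ q) (hr : 1 ≤ r) {δ : ℝ} (hδ : 0 < δ) {K : Finset (Space d)} (hK : K.card ≤ P.n)
    (ξ : Space d → Space d) (M : ℕ) (y : Space d → ℕ → Space d) (s : Space d → ℕ → ℝ)
    (s₀ : Space d → ℝ) (hs : ∀ ω ∈ K, ∀ j < M, δ ^ 2 * |s ω j - s₀ ω| ≤ 1)
    (hy : ∀ ω ∈ K, ∀ i < M, ∀ j < M, i ≠ j →
      2 * (M : ℝ) ≤ ‖δ • ((y ω i - y ω j) + (2 * (s ω i - s ω j)) • ξ ω)‖)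
    {G : SpaceTime d → ℂ} (hG : ∀ w, G w = ∑ ω ∈ K, ∑ j ∈ Finset.range M,
      packet P.φ δ (ξ ω) (w - WithLp.toLp 2 (y ω j, s ω j))) :
    mixedNorm q r G ≤ ENNReal.ofReal ((M * ((δ ^ d)⁻¹ * P.I)) ^ (r⁻¹).toReal *
      ((δ ^ 2)⁻¹ * P.J) ^ (q⁻¹).toReal * (8 * P.C * P.n)) := by
  have hC := P.C_pos
  have hI := P.I_pos
  have hJ := P.J_pos
  let a : Space d → ℕ → ℝ → Space d := fun ω j t => y ω j - (2 * (t - s ω j)) • ξ ω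
  let v : Space d → ℝ → ℝ := fun ω t => decay 2 (δ ^ 2 * (t - s₀ ω))
  have hv : ∀ ω t, 0 ≤ v ω t := fun ω t => (decay_pos _ _).le
  have hpt : ∀ t x, ‖G (WithLp.toLp 2 (x, t))‖ ≤ ∑ ω ∈ K, (4 * P.C * v ω t) *
      ∑ j ∈ Finset.range M, decay (d + 1) (δ • (x - a ω j t)) := by
    intro t x
    rw [hG]
    refine (norm_sum_le _ _).trans (Finset.sum_le_sum fun ω hω => ?_)
    rw [Finset.mul_sum]
    refine (norm_sum_le _ _).trans (Finset.sum_le_sum fun j hj => ?_)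
    refine (P.norm_packet_le δ (ξ ω) (x - y ω j) (t - s ω j)).trans ?_
    have h1 : decay 2 (δ ^ 2 * (t - s ω j)) ≤ 4 * v ω t := by
      refine decay_two_le_four_mul ?_
      have h2 := hs ω hω j (Finset.mem_range.1 hj)
      rw [← mul_sub, abs_mul, abs_of_pos (by positivity : 0 < δ ^ 2)]
      convert h2 using 2
      rw [abs_sub_comm]
      congr 1
      ring
    have h2 : x - y ω j + (2 * (t - s ω j)) • ξ ω = x - a ω j t := by
      simp only [a]; abel
    rw [h2]
    have h3 := (decay_pos (d + 1) (δ • (x - a ω j t))).le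
    calc _ ≤ P.C * (decay (d + 1) (δ • (x - a ω j t)) * (4 * v ω t)) := by gcongr
      _ = _ := by ring
  have hsep : ∀ t x, ∀ ω ∈ K, ∑ j ∈ Finset.range M, decay (d + 1) (δ • (x - a ω j t)) ≤ 2 := by
    intro t x ω hω
    refine sum_decay_le_two d.succ_ne_zero _ _ fun i hi j hj hij => ?_
    rw [Finset.card_range, ← smul_sub]
    rw [Finset.mem_range] at hi hj
    refine (hy ω hω j hj i hi hij.symm).trans_eq ?_
    congr 2
    simp only [a]
    module
  have hn : (K.card : ℝ) ≤ P.n := by exact_mod_cast hK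
  have key := mixedNorm_le (A := ENNReal.ofReal (M * ((δ ^ d)⁻¹ * P.I)))
    (B := ENNReal.ofReal ((δ ^ 2)⁻¹ * P.J)) (S := ENNReal.ofReal (8 * P.C * P.n)) hq hr
    ENNReal.ofReal_ne_top ENNReal.ofReal_ne_top (G := G)
    (V := fun t => ENNReal.ofReal (∑ ω ∈ K, (8 * P.C) * v ω t)) ?_ ?_ ?_ ?_
  · refine key.trans_eq ?_
    rw [ENNReal.ofReal_rpow_of_nonneg (by positivity) (by positivity),
      ENNReal.ofReal_rpow_of_nonneg (by positivity) (by positivity),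
      ← ENNReal.ofReal_mul (by positivity), ← ENNReal.ofReal_mul (by positivity)]
  · intro t x
    rw [← ofReal_norm]
    refine ENNReal.ofReal_le_ofReal ((hpt t x).trans (Finset.sum_le_sum fun ω hω => ?_))
    have := hv ω t
    calc _ ≤ (4 * P.C * v ω t) * 2 := by gcongr; exact hsep t x ω hω
      _ = _ := by ring
  · intro t
    have h1 := lintegral_ofReal_sum_le (μ := (volume : Measure (Space d))) (K ×ˢ Finset.range M)
      (c := fun k => 4 * P.C * v k.1 t) (D := fun k x => decay (d + 1) (δ • (x - a k.1 k.2 t)))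
      (X := (δ ^ d)⁻¹ * P.I) (fun k _ => by have := hv k.1 t; positivity)
      (fun k _ x => (decay_pos _ _).le)
      (fun k _ => ((continuous_decay (d + 1)).comp (by fun_prop)).measurable) (by positivity)
      (fun k _ => P.lintegral_space_le δ hδ _)
    calc ∫⁻ x : Space d, ‖G (WithLp.toLp 2 (x, t))‖ₑ
        ≤ ∫⁻ x : Space d, ENNReal.ofReal (∑ k ∈ K ×ˢ Finset.range M,
          4 * P.C * v k.1 t * decay (d + 1) (δ • (x - a k.1 k.2 t))) := by
          refine lintegral_mono fun x => ?_
          rw [← ofReal_norm]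
          refine ENNReal.ofReal_le_ofReal ((hpt t x).trans_eq ?_)
          rw [Finset.sum_product]
          exact Finset.sum_congr rfl fun ω _ => Finset.mul_sum _ _ _
      _ ≤ _ := h1
      _ ≤ _ := by
        rw [← ENNReal.ofReal_mul (by positivity)]
        refine ENNReal.ofReal_le_ofReal ?_
        rw [Finset.sum_product]
        simp only [Finset.sum_const, Finset.card_range, nsmul_eq_mul]
        rw [← Finset.mul_sum, ← Finset.mul_sum, ← Finset.mul_sum]
        have h2 : 0 ≤ ∑ ω ∈ K, v ω t := Finset.sum_nonneg fun ω _ => hv ω t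
        have h3 : 0 ≤ (M : ℝ) * ((δ ^ d)⁻¹ * P.I) * (P.C * ∑ ω ∈ K, v ω t) := by positivity
        nlinarith
  · intro t
    refine ENNReal.ofReal_le_ofReal ?_
    calc ∑ ω ∈ K, 8 * P.C * v ω t ≤ ∑ _ω ∈ K, 8 * P.C :=
          Finset.sum_le_sum fun ω _ => mul_le_of_le_one_right (by positivity) (decay_le_one _ _)
      _ = 8 * P.C * K.card := by rw [Finset.sum_const, nsmul_eq_mul, mul_comm]
      _ ≤ _ := by gcongr
  · have h1 := lintegral_ofReal_sum_le (μ := (volume : Measure ℝ)) K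
      (c := fun _ => 8 * P.C) (D := v) (X := (δ ^ 2)⁻¹ * P.J) (fun k _ => by positivity)
      (fun k _ t => hv k t)
      (fun k _ => ((continuous_decay 2).comp (by fun_prop)).measurable) (by positivity)
      (fun k _ => P.lintegral_time_le (δ ^ 2) (by positivity) _)
    refine h1.trans ?_
    rw [← ENNReal.ofReal_mul (by positivity)]
    refine ENNReal.ofReal_le_ofReal ?_
    rw [Finset.sum_const, nsmul_eq_mul]
    calc (K.card : ℝ) * (8 * P.C) * ((δ ^ 2)⁻¹ * P.J) ≤ P.n * (8 * P.C) * ((δ ^ 2)⁻¹ * P.J) := by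
          gcongr
      _ = _ := by ring

/-- Lower bound for the decoupling constant from a single test function. -/
theorem le_decouplingConst {d : ℕ} {q r : ℝ≥0∞} {δ : ℝ} {Ξ : Finset (Space d)}
    (f : 𝓢(SpaceTime d, ℂ))
    (hf : Function.support (𝓕 (f : SpaceTime d → ℂ)) ⊆ ⋃ ω ∈ Ξ, tau d δ ω) {ℓ u : ℝ} (hu : 0 < u)
    (hΞ : Ξ.Nonempty) (hℓ : ENNReal.ofReal ℓ ≤ mixedNorm q r (∑ ω ∈ Ξ, proj (tau d δ ω) f))
    (hle : ∀ ω ∈ Ξ, mixedNorm q r (proj (tau d δ ω) f) ≤ ENNReal.ofReal u) :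
    ENNReal.ofReal (ℓ / ((Ξ.card : ℝ) ^ (1 / 2 : ℝ) * u)) ≤ decouplingConst d q r δ Ξ := by
  have hcard : (0 : ℝ) < Ξ.card := by exact_mod_cast hΞ.card_pos
  refine le_sInf fun D hD => ?_
  have h1 : (∑ ω ∈ Ξ, mixedNorm q r (proj (tau d δ ω) f) ^ 2) ^ (1 / 2 : ℝ) ≤
      ENNReal.ofReal ((Ξ.card : ℝ) ^ (1 / 2 : ℝ) * u) := by
    calc _ ≤ (∑ _ω ∈ Ξ, ENNReal.ofReal u ^ 2) ^ (1 / 2 : ℝ) := by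
          gcongr with ω hω
          exact hle ω hω
      _ = ENNReal.ofReal ((Ξ.card * u ^ 2) ^ (1 / 2 : ℝ)) := by
          rw [Finset.sum_const, nsmul_eq_mul, ← ENNReal.ofReal_natCast,
            ← ENNReal.ofReal_pow hu.le, ← ENNReal.ofReal_mul hcard.le,
            ENNReal.ofReal_rpow_of_nonneg (by positivity) (by norm_num)]
      _ = _ := by
          rw [Real.mul_rpow hcard.le (by positivity), ← Real.sqrt_eq_rpow (u ^ 2),
            Real.sqrt_sq hu.le]
  rw [ENNReal.ofReal_div_of_pos (by positivity)]
  refine ENNReal.div_le_of_le_mul (hℓ.trans ((hD f hf).trans ?_))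
  gcongr

/-! ### Lower bounds for superpositions of wave packets -/

theorem ofReal_le_mixedNorm {d : ℕ} {q r : ℝ≥0∞} (hq : 1 ≤ q) (hr : 1 ≤ r) {a X Y : ℝ}
    (ha : 0 ≤ a) (hX : 0 < X) (hY : 0 < Y) {G : SpaceTime d → ℂ} {T : Set ℝ}
    (hT : MeasurableSet T) (hYT : ENNReal.ofReal Y ≤ volume T)
    (h : ∀ t ∈ T, ∃ s : Set (Space d), MeasurableSet s ∧ ENNReal.ofReal X ≤ volume s ∧
      ∀ x ∈ s, a ≤ ‖G (WithLp.toLp 2 (x, t))‖) :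
    ENNReal.ofReal (a * X ^ (r⁻¹).toReal * Y ^ (q⁻¹).toReal) ≤ mixedNorm q r G := by
  have hT0 : volume T ≠ 0 := ((ENNReal.ofReal_pos.2 hY).trans_le hYT).ne'
  refine le_trans ?_ (le_mixedNorm (a := ENNReal.ofReal a) (X := ENNReal.ofReal X)
    (zero_lt_one.trans_le hq).ne' (zero_lt_one.trans_le hr).ne' (ENNReal.ofReal_pos.2 hX).ne'
    hT hT0 fun t ht => ?_)
  · rw [ENNReal.ofReal_mul (by positivity), ENNReal.ofReal_mul ha,
      ← ENNReal.ofReal_rpow_of_nonneg hX.le (by positivity),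
      ← ENNReal.ofReal_rpow_of_nonneg hY.le (by positivity)]
    gcongr
  · obtain ⟨s, hs, hXs, has⟩ := h t ht
    exact ⟨s, hs, hXs, fun x hx => by
      rw [← ofReal_norm]; exact ENNReal.ofReal_le_ofReal (has x hx)⟩

/-- A packet with `‖ξ‖ ≤ 2√d` drifts by at most `4√d A` during a time `A`. -/
theorem le_norm_smul_add {d : ℕ} {δ : ℝ} (hδ : 0 < δ) {ξ x : Space d} {a A : ℝ}
    (hξ : ‖ξ‖ ≤ 2 * √d) (ha : |a| ≤ A) :
    δ * (‖x‖ - 4 * √d * A) ≤ ‖δ • (x + (2 * a) • ξ)‖ := by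
  rw [norm_smul, Real.norm_eq_abs, abs_of_pos hδ]
  have h1 : ‖(2 * a) • ξ‖ ≤ 2 * A * (2 * √d) := by
    rw [norm_smul, Real.norm_eq_abs, abs_mul, abs_two]
    have := (abs_nonneg a).trans ha
    gcongr
  have h2 : ‖x‖ ≤ ‖x + (2 * a) • ξ‖ + ‖(2 * a) • ξ‖ := by
    simpa using norm_sub_le (x + (2 * a) • ξ) ((2 * a) • ξ)
  gcongr
  linarith

theorem le_abs_natCast_mul_sub {i j : ℕ} (hij : i ≠ j) {L : ℝ} (hL : 0 ≤ L) :
    L ≤ |i * L - j * L| := by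
  rw [← sub_mul, abs_mul, abs_of_nonneg hL]
  have h : (1 : ℝ) ≤ |(i : ℝ) - j| := by
    have : 1 ≤ |(i : ℤ) - j| := Int.one_le_abs (sub_ne_zero.2 (by exact_mod_cast hij))
    exact_mod_cast this
  nlinarith

theorem le_norm_natCast_mul_smul_sub {E : Type*} [NormedAddCommGroup E] [NormedSpace ℝ E]
    {e : E} (he : ‖e‖ = 1) {i j : ℕ} (hij : i ≠ j) {L : ℝ} (hL : 0 ≤ L) :
    L ≤ ‖((i : ℝ) * L) • e - ((j : ℝ) * L) • e‖ := by
  rw [← sub_smul, norm_smul, he, mul_one]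
  exact le_abs_natCast_mul_sub hij hL

theorem exists_norm_eq_one {d : ℕ} (hd : 1 ≤ d) : ∃ e : Space d, ‖e‖ = 1 :=
  ⟨EuclideanSpace.single ⟨0, hd⟩ 1, by simp⟩

/-- Numbering the net allows packet centres to be placed along an arithmetic progression. -/
theorem exists_nat_injOn {α : Type*} (s : Finset α) : ∃ k : α → ℕ, Set.InjOn k s :=
  Set.countable_iff_exists_injOn.1 s.countable_toSet

theorem PacketFamily.norm_packet_le_of_space {d : ℕ} (P : PacketFamily d) {δ Λ t : ℝ}
    {ξ x : Space d} (hΛ : 0 < Λ) (h : Λ ≤ ‖δ • (x + (2 * t) • ξ)‖) :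
    ‖packet P.φ δ ξ (WithLp.toLp 2 (x, t))‖ ≤ P.C * Λ⁻¹ := by
  refine (P.norm_packet_le δ ξ x t).trans ?_
  have hC := P.C_pos
  have h1 := decay_le_inv d.succ_ne_zero hΛ h
  have h2 := decay_le_one 2 (δ ^ 2 * t)
  have h3 := (decay_pos 2 (δ ^ 2 * t)).le
  calc _ ≤ P.C * (Λ⁻¹ * 1) := by gcongr
    _ = _ := by ring

theorem PacketFamily.norm_packet_le_of_time {d : ℕ} (P : PacketFamily d) {δ Λ t : ℝ}
    {ξ x : Space d} (hΛ : 0 < Λ) (h : Λ ≤ |δ ^ 2 * t|) :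
    ‖packet P.φ δ ξ (WithLp.toLp 2 (x, t))‖ ≤ P.C * Λ⁻¹ := by
  refine (P.norm_packet_le δ ξ x t).trans ?_
  have hC := P.C_pos
  have h1 := decay_le_inv (k := 2) (u := δ ^ 2 * t) two_ne_zero hΛ (by rwa [Real.norm_eq_abs])
  have h2 := decay_le_one (d + 1) (δ • (x + (2 * t) • ξ))
  have h3 := (decay_pos (d + 1) (δ • (x + (2 * t) • ξ))).le
  calc _ ≤ P.C * (1 * Λ⁻¹) := by
        gcongr
        exact (decay_pos _ _).le
    _ = _ := by ring

/-- One packet dominates: its multiplicity is at least `1`, and the tails of all the others total at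
most `1/4`. -/
theorem quarter_le_norm_sum {ι : Type*} {s : Finset ι} {i : ι} (hi : i ∈ s) {m : ι → ℕ}
    {p : ι → ℂ} {n : ℕ} {b : ℝ} (hb : 0 ≤ b) (hm : ∀ j ∈ s, 1 ≤ m j ∧ m j ≤ n)
    (hp : 1 / 2 ≤ ‖p i‖) (hpb : ∀ j ∈ s, j ≠ i → ‖p j‖ ≤ b)
    (hsmall : (s.card : ℝ) * (n * b) ≤ 1 / 4) :
    1 / 4 ≤ ‖∑ j ∈ s, (m j : ℂ) * p j‖ := by
  classical
  rw [← Finset.add_sum_erase _ _ hi]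
  have h1 : 1 / 2 ≤ ‖(m i : ℂ) * p i‖ := by
    rw [norm_mul, Complex.norm_natCast]
    have : (1 : ℝ) ≤ m i := by exact_mod_cast (hm i hi).1
    nlinarith [norm_nonneg (p i)]
  have h2 : ‖∑ j ∈ s.erase i, (m j : ℂ) * p j‖ ≤ 1 / 4 := by
    calc _ ≤ ∑ j ∈ s.erase i, (n : ℝ) * b := by
          refine (norm_sum_le _ _).trans (Finset.sum_le_sum fun j hj => ?_)
          rw [norm_mul, Complex.norm_natCast]
          have hjs := Finset.mem_of_mem_erase hj
          have h3 : (m j : ℝ) ≤ n := by exact_mod_cast (hm j hjs).2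
          have h4 := hpb j hjs (Finset.ne_of_mem_erase hj)
          gcongr
      _ ≤ (s.card : ℝ) * (n * b) := by
          rw [Finset.sum_const, nsmul_eq_mul]
          gcongr
          exact Finset.erase_subset _ _
      _ ≤ _ := hsmall
  have h3 := norm_sub_le_norm_add ((m i : ℂ) * p i) (∑ j ∈ s.erase i, (m j : ℂ) * p j)
  linarith

theorem volume_ball_space {d : ℕ} (x : Space d) {R : ℝ} (hR : 0 < R) :
    volume (Metric.ball x R) =
      ENNReal.ofReal (R ^ d * (volume (Metric.ball (0 : Space d) 1)).toReal) := by
  rw [Measure.addHaar_ball_of_pos _ _ hR, finrank_euclideanSpace, Fintype.card_fin,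
    ENNReal.ofReal_mul (by positivity), ENNReal.ofReal_toReal measure_ball_lt_top.ne]

theorem volume_ball_toReal_pos (d : ℕ) : 0 < (volume (Metric.ball (0 : Space d) 1)).toReal :=
  ENNReal.toReal_pos (Metric.measure_ball_pos _ _ zero_lt_one).ne' measure_ball_lt_top.ne

/-! ### The three examples -/

/-- All packets focus simultaneously at `M` points with distinct time coordinates. -/
theorem PacketFamily.focusing_le_decouplingConst {d : ℕ} (hd : 1 ≤ d) (P : PacketFamily d)
    {q r : ℝ≥0∞} (hq : 1 ≤ q) (hr : 1 ≤ r) {δ : ℝ} (hδ : 0 < δ) (hδ1 : δ < 1)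
    {Ξ : Finset (Space d)} (hΞ : IsSeparatedIn d δ (Ξ : Set (Space d))) (hne : Ξ.Nonempty)
    {M : ℕ} (hM : 1 ≤ M) (hMδ : δ ^ 2 * M ≤ 1) :
    ENNReal.ofReal (((Ξ.card : ℝ) / 4 *
        (P.ρ ^ d * (volume (Metric.ball (0 : Space d) 1)).toReal) ^ (r⁻¹).toReal *
        (M * P.ρ) ^ (q⁻¹).toReal) / ((Ξ.card : ℝ) ^ (1 / 2 : ℝ) *
        ((M * ((δ ^ d)⁻¹ * P.I)) ^ (r⁻¹).toReal * ((δ ^ 2)⁻¹ * P.J) ^ (q⁻¹).toReal *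
          (8 * P.C * P.n)))) ≤ decouplingConst d q r δ Ξ := by
  have hC := P.C_pos
  have hI := P.I_pos
  have hJ := P.J_pos
  have hρ := P.ρ_pos
  have hn : (0 : ℝ) < P.n := by exact_mod_cast P.n_pos
  have hM0 : (0 : ℝ) < M := by exact_mod_cast hM
  have hX := volume_ball_toReal_pos d
  have hs := Real.sqrt_nonneg (d : ℝ)
  obtain ⟨ξ, nb, m, hprop, hex⟩ := P.exists_schwartz δ hδ hδ1 Ξ hΞ
  obtain ⟨e, he⟩ := exists_norm_eq_one hd
  -- The term `2M` is the separation needed for the upper bound; `4CM` makes the `M` tails `C / Λ`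
  -- total at most `1/4`. In `L`, the `1` absorbs the ball of radius `ρ` and `4√d M` the drift
  -- during a time `M`.
  set Λ : ℝ := 2 * M + 4 * P.C * M with hΛ
  have hΛ0 : 0 < Λ := by positivity
  set L : ℝ := δ⁻¹ * Λ + 1 + 4 * √d * M with hL
  have hL0 : 0 ≤ L := by positivity
  have hδL : δ * (L - 1 - 4 * √d * M) = Λ := by rw [hL]; field_simp; ring
  let y : ℕ → Space d := fun j => ((j : ℝ) * L) • e
  let s : ℕ → ℝ := fun j => j * P.ρ
  have hs0 : ∀ j, 0 ≤ s j := fun j => by positivity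
  have hsM : ∀ j < M, s j ≤ M := fun j hj => by
    have : (j : ℝ) ≤ M := by exact_mod_cast hj.le
    calc (j : ℝ) * P.ρ ≤ M * 1 := by gcongr; exact P.ρ_le_one
      _ = M := mul_one _
  obtain ⟨f, hf, hproj, hsum⟩ := hex M fun _ j => WithLp.toLp 2 (y j, s j)
  refine le_decouplingConst f hf (by positivity) hne ?_ fun ω hω => ?_
  · have hT : ENNReal.ofReal (M * P.ρ) ≤ volume (Set.Ico 0 (M * P.ρ)) := by
      rw [Real.volume_Ico, sub_zero]
    refine ofReal_le_mixedNorm hq hr (by positivity) (by positivity) (by positivity)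
      measurableSet_Ico hT fun t ht => ?_
    -- The focusing point whose time slot contains `t`.
    set j₀ := ⌊t / P.ρ⌋₊ with hj₀
    have htρ : 0 ≤ t / P.ρ := div_nonneg ht.1 hρ.le
    have hj₀M : j₀ < M := (Nat.floor_lt htρ).2 (by rw [div_lt_iff₀ hρ]; exact ht.2)
    have h1 : s j₀ ≤ t := by
      have := Nat.floor_le htρ
      rwa [le_div_iff₀ hρ] at this
    have h2 : t ≤ s j₀ + P.ρ := by
      have := (Nat.lt_floor_add_one (t / P.ρ)).le
      rw [div_le_iff₀ hρ] at this
      simp only [s]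
      linarith
    have htM : t ≤ M := ht.2.le.trans (mul_le_of_le_one_right hM0.le P.ρ_le_one)
    refine ⟨Metric.ball (y j₀) P.ρ, measurableSet_ball, (volume_ball_space _ hρ).ge,
      fun x hx => ?_⟩
    rw [mem_ball_iff_norm] at hx
    rw [hsum]
    refine le_trans ?_ (Complex.re_le_norm _)
    rw [Complex.re_sum]
    have hterm : ∀ ω ∈ Ξ, 1 / 4 ≤ ((m ω : ℂ) * ∑ j ∈ Finset.range M,
        packet P.φ δ (ξ ω) (WithLp.toLp 2 (x, t) - WithLp.toLp 2 (y j, s j))).re := by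
      intro ω hω
      obtain ⟨hξ, -, -, hm, -⟩ := hprop ω hω
      rw [← Complex.ofReal_natCast, Complex.re_ofReal_mul, ← Finset.add_sum_erase _ _ (Finset.mem_range.2 hj₀M),
        Complex.add_re]
      have h3 := P.half_le_re δ (ξ ω) (x - y j₀) (t - s j₀) hδ hδ1 hξ hx.le
        (abs_le.2 ⟨by linarith, by linarith⟩)
      have h4 : ‖∑ j ∈ (Finset.range M).erase j₀, packet P.φ δ (ξ ω)
          (WithLp.toLp 2 (x, t) - WithLp.toLp 2 (y j, s j))‖ ≤ 1 / 4 := by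
        calc _ ≤ ∑ j ∈ (Finset.range M).erase j₀, P.C * Λ⁻¹ := by
              refine (norm_sum_le _ _).trans (Finset.sum_le_sum fun j hj => ?_)
              refine P.norm_packet_le_of_space (x := x - y j) (t := t - s j) hΛ0 ?_
              have hjM := Finset.mem_range.1 (Finset.mem_of_mem_erase hj)
              refine le_trans ?_ (le_norm_smul_add hδ hξ (A := M)
                (abs_le.2 ⟨by linarith [hsM j hjM, ht.1], by linarith [hs0 j]⟩))
              rw [← hδL]
              gcongr
              have h5 : L ≤ ‖y j₀ - y j‖ :=
                le_norm_natCast_mul_smul_sub he (Finset.ne_of_mem_erase hj).symm hL0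
              have h6 : ‖y j₀ - y j‖ ≤ ‖x - y j‖ + ‖x - y j₀‖ := by
                simpa using norm_sub_le (x - y j) (x - y j₀)
              linarith [P.ρ_le_one]
          _ ≤ M * (P.C * Λ⁻¹) := by
              rw [Finset.sum_const, nsmul_eq_mul]
              gcongr
              exact (Finset.card_erase_le).trans_eq (Finset.card_range M)
          _ ≤ 1 / 4 := by
              rw [← mul_assoc, ← div_eq_mul_inv, div_le_iff₀ hΛ0, hΛ]
              linarith
      have h5 := (abs_le.1 ((Complex.abs_re_le_norm _).trans h4)).1
      have h6 : (1 : ℝ) ≤ m ω := by exact_mod_cast hm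
      have h7 : 1 / 4 ≤ (packet P.φ δ (ξ ω)
          (WithLp.toLp 2 (x, t) - WithLp.toLp 2 (y j₀, s j₀))).re +
          (∑ j ∈ (Finset.range M).erase j₀, packet P.φ δ (ξ ω)
            (WithLp.toLp 2 (x, t) - WithLp.toLp 2 (y j, s j))).re := by
        have h8 : 1 / 2 ≤ (packet P.φ δ (ξ ω)
          (WithLp.toLp 2 (x, t) - WithLp.toLp 2 (y j₀, s j₀))).re := h3
        linarith
      nlinarith
    calc (Ξ.card : ℝ) / 4 = ∑ _ω ∈ Ξ, (1 / 4 : ℝ) := by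
          rw [Finset.sum_const, nsmul_eq_mul]; ring
      _ ≤ _ := Finset.sum_le_sum hterm
  · obtain ⟨-, hcard, hsub, -⟩ := hprop ω hω
    refine P.mixedNorm_sum_packet_le hq hr hδ hcard ξ M (fun _ => y) (fun _ => s) (fun _ => 0)
      (fun ω' _ j hj => ?_) (fun ω' hω' i hi j hj hij => ?_) (hproj ω hω)
    · rw [sub_zero, abs_of_nonneg (hs0 j)]
      exact le_trans (by gcongr; exact hsM j hj) hMδ
    · refine le_trans ?_ (le_norm_smul_add hδ (hprop ω' (hsub hω')).1 (A := M)
        (abs_le.2 ⟨by linarith [hsM j hj, hs0 i], by linarith [hs0 j, hsM i hi]⟩))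
      have h1 : L ≤ ‖y i - y j‖ := le_norm_natCast_mul_smul_sub he hij hL0
      have h2 : δ * (L - 1 - 4 * √d * M) ≤ δ * (‖y i - y j‖ - 4 * √d * M) := by
        gcongr
        linarith
      have : 0 ≤ 4 * P.C * M := by positivity
      linarith

/-- The packets are separated in space. -/
theorem PacketFamily.space_le_decouplingConst {d : ℕ} (hd : 1 ≤ d) (P : PacketFamily d)
    {q r : ℝ≥0∞} (hq : 1 ≤ q) (hr : 1 ≤ r) {δ : ℝ} (hδ : 0 < δ) (hδ1 : δ < 1)
    {Ξ : Finset (Space d)} (hΞ : IsSeparatedIn d δ (Ξ : Set (Space d))) (hne : Ξ.Nonempty) :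
    ENNReal.ofReal ((1 / 4 * (Ξ.card * ((P.ρ / δ) ^ d *
          (volume (Metric.ball (0 : Space d) 1)).toReal)) ^ (r⁻¹).toReal *
        ((δ ^ 2)⁻¹ * P.ρ) ^ (q⁻¹).toReal) / ((Ξ.card : ℝ) ^ (1 / 2 : ℝ) *
        (((δ ^ d)⁻¹ * P.I) ^ (r⁻¹).toReal * ((δ ^ 2)⁻¹ * P.J) ^ (q⁻¹).toReal *
          (8 * P.C * P.n)))) ≤ decouplingConst d q r δ Ξ := by
  have hC := P.C_pos
  have hI := P.I_pos
  have hJ := P.J_pos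
  have hρ := P.ρ_pos
  have hn : (0 : ℝ) < P.n := by exact_mod_cast P.n_pos
  have hN : (0 : ℝ) < Ξ.card := by exact_mod_cast hne.card_pos
  have hX := volume_ball_toReal_pos d
  have hs := Real.sqrt_nonneg (d : ℝ)
  obtain ⟨ξ, nb, m, hprop, hex⟩ := P.exists_schwartz δ hδ hδ1 Ξ hΞ
  obtain ⟨e, he⟩ := exists_norm_eq_one hd
  obtain ⟨k, hk⟩ := exists_nat_injOn Ξ
  -- Chosen so that `N · n · C / Λ = 1/4`. In `L`, the term `8√d δ⁻²` absorbs the drift of two tubes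
  -- up to time `δ⁻²`.
  set Λ : ℝ := 4 * Ξ.card * P.n * P.C with hΛ
  have hΛ0 : 0 < Λ := by positivity
  set L : ℝ := δ⁻¹ * (Λ + 2) + 8 * √d * (δ ^ 2)⁻¹ with hL
  have hL0 : 0 ≤ L := by positivity
  let y : Space d → Space d := fun ω => ((k ω : ℝ) * L) • e
  obtain ⟨f, hf, hproj, hsum⟩ := hex 1 fun ω _ => WithLp.toLp 2 (y ω, 0)
  refine le_decouplingConst f hf (by positivity) hne ?_ fun ω hω => ?_
  · have hT : ENNReal.ofReal ((δ ^ 2)⁻¹ * P.ρ) ≤ volume (Set.Icc 0 ((δ ^ 2)⁻¹ * P.ρ)) := by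
      rw [Real.volume_Icc, sub_zero]
    refine ofReal_le_mixedNorm hq hr (by positivity) (by positivity) (by positivity)
      measurableSet_Icc hT fun t ht => ?_
    have htδ : t ≤ (δ ^ 2)⁻¹ := ht.2.trans (mul_le_of_le_one_right (by positivity) P.ρ_le_one)
    let c : Space d → Space d := fun ω => y ω - (2 * t) • ξ ω
    have hcc : ∀ ω ∈ Ξ, ∀ ω' ∈ Ξ, ω ≠ ω' → δ⁻¹ * (Λ + 2) ≤ ‖c ω - c ω'‖ := by
      intro ω hω ω' hω' hne'
      have h1 : L ≤ ‖y ω - y ω'‖ :=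
        le_norm_natCast_mul_smul_sub he (fun h => hne' (hk hω hω' h)) hL0
      have h2 : ∀ ω ∈ Ξ, ‖(2 * t) • ξ ω‖ ≤ 2 * (δ ^ 2)⁻¹ * (2 * √d) := fun ω hω => by
        rw [norm_smul, Real.norm_eq_abs, abs_mul, abs_two, abs_of_nonneg ht.1]
        gcongr
        exact (hprop ω hω).1
      have h3 : y ω - y ω' = (c ω - c ω') + ((2 * t) • ξ ω - (2 * t) • ξ ω') := by
        simp only [c]; abel
      have h4 := norm_add_le (c ω - c ω') ((2 * t) • ξ ω - (2 * t) • ξ ω')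
      have h5 := norm_sub_le ((2 * t) • ξ ω) ((2 * t) • ξ ω')
      rw [← h3] at h4
      linarith [h2 ω hω, h2 ω' hω']
    have hδx : ∀ (x : Space d) (ω : Space d),
        ‖δ • (x - y ω + (2 * t) • ξ ω)‖ = δ * ‖x - c ω‖ := fun x ω => by
      rw [norm_smul, Real.norm_eq_abs, abs_of_pos hδ]
      congr 2
      simp only [c]; abel
    have hdisj : (Ξ : Set (Space d)).PairwiseDisjoint fun ω => Metric.ball (c ω) (P.ρ / δ) := by
      intro ω hω ω' hω' hne'
      refine Metric.ball_disjoint_ball ?_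
      rw [dist_eq_norm]
      refine le_trans ?_ (hcc ω hω ω' hω' hne')
      rw [← add_div, div_eq_inv_mul]
      exact mul_le_mul_of_nonneg_left (by linarith [P.ρ_le_one]) (by positivity)
    refine ⟨⋃ ω ∈ Ξ, Metric.ball (c ω) (P.ρ / δ),
      Finset.measurableSet_biUnion _ fun ω _ => measurableSet_ball, ?_, fun x hx => ?_⟩
    · rw [measure_biUnion_finset hdisj fun ω _ => measurableSet_ball]
      simp only [volume_ball_space _ (div_pos hρ hδ), Finset.sum_const, nsmul_eq_mul]
      rw [ENNReal.ofReal_mul (Nat.cast_nonneg _), ENNReal.ofReal_natCast]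
    · simp only [Set.mem_iUnion] at hx
      obtain ⟨ω, hω, hx⟩ := hx
      rw [mem_ball_iff_norm] at hx
      have hδx' : δ * ‖x - c ω‖ ≤ P.ρ := by
        rw [lt_div_iff₀ hδ] at hx
        linarith
      rw [hsum]
      simp only [Finset.sum_range_one]
      refine quarter_le_norm_sum (b := P.C * Λ⁻¹) (n := P.n) hω (by positivity)
        (fun ω hω => (hprop ω hω).2.2.2) ?_ (fun ω' hω' hne' => ?_) ?_
      · refine P.half_le_norm δ (ξ ω) (x - y ω) (t - 0) ?_ ?_
        · rw [sub_zero, hδx]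
          exact hδx'
        · rw [sub_zero, abs_of_nonneg (mul_nonneg (by positivity) ht.1)]
          calc δ ^ 2 * t ≤ δ ^ 2 * ((δ ^ 2)⁻¹ * P.ρ) := by gcongr; exact ht.2
            _ = P.ρ := by field_simp
      · refine P.norm_packet_le_of_space (x := x - y ω') (t := t - 0) hΛ0 ?_
        rw [sub_zero, hδx]
        have h1 := hcc ω hω ω' hω' hne'.symm
        rw [inv_mul_le_iff₀ hδ] at h1
        have h2 : ‖c ω - c ω'‖ ≤ ‖x - c ω'‖ + ‖x - c ω‖ := by
          simpa using norm_sub_le (x - c ω') (x - c ω)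
        have h3 : δ * ‖c ω - c ω'‖ ≤ δ * (‖x - c ω'‖ + ‖x - c ω‖) := by gcongr
        linarith [P.ρ_le_one]
      · rw [hΛ]
        refine le_of_eq ?_
        field_simp
  · obtain ⟨-, hcard, -⟩ := hprop ω hω
    have h := P.mixedNorm_sum_packet_le hq hr hδ hcard ξ 1 (fun ω _ => y ω) (fun _ _ => 0)
      (fun _ => 0) (fun ω' _ j hj => by simp) (fun ω' hω' i hi j hj hij => by omega) (hproj ω hω)
    simpa only [Nat.cast_one, one_mul] using h

/-- The packets are separated in time. -/
theorem PacketFamily.time_le_decouplingConst {d : ℕ} (P : PacketFamily d)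
    {q r : ℝ≥0∞} (hq : 1 ≤ q) (hr : 1 ≤ r) {δ : ℝ} (hδ : 0 < δ) (hδ1 : δ < 1)
    {Ξ : Finset (Space d)} (hΞ : IsSeparatedIn d δ (Ξ : Set (Space d))) (hne : Ξ.Nonempty) :
    ENNReal.ofReal ((1 / 4 * ((P.ρ / δ) ^ d *
          (volume (Metric.ball (0 : Space d) 1)).toReal) ^ (r⁻¹).toReal *
        (Ξ.card * ((δ ^ 2)⁻¹ * P.ρ)) ^ (q⁻¹).toReal) / ((Ξ.card : ℝ) ^ (1 / 2 : ℝ) *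
        (((δ ^ d)⁻¹ * P.I) ^ (r⁻¹).toReal * ((δ ^ 2)⁻¹ * P.J) ^ (q⁻¹).toReal *
          (8 * P.C * P.n)))) ≤ decouplingConst d q r δ Ξ := by
  have hC := P.C_pos
  have hI := P.I_pos
  have hJ := P.J_pos
  have hρ := P.ρ_pos
  have hn : (0 : ℝ) < P.n := by exact_mod_cast P.n_pos
  have hN : (0 : ℝ) < Ξ.card := by exact_mod_cast hne.card_pos
  have hX := volume_ball_toReal_pos d
  obtain ⟨ξ, nb, m, hprop, hex⟩ := P.exists_schwartz δ hδ hδ1 Ξ hΞ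
  obtain ⟨k, hk⟩ := exists_nat_injOn Ξ
  set Λ : ℝ := 4 * Ξ.card * P.n * P.C with hΛ
  have hΛ0 : 0 < Λ := by positivity
  -- The `1` absorbs the half-lifetime `ρ ≤ 1` of the dominant packet, in units of `δ⁻²`.
  set L : ℝ := (δ ^ 2)⁻¹ * (Λ + 1) with hL
  have hL0 : 0 ≤ L := by positivity
  have hδL : δ ^ 2 * L = Λ + 1 := by rw [hL]; field_simp
  have hρδ : (δ ^ 2)⁻¹ * P.ρ ≤ L := by
    rw [hL]; gcongr; linarith [P.ρ_le_one]
  let s : Space d → ℝ := fun ω => k ω * L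
  have hss : ∀ ω ∈ Ξ, ∀ ω' ∈ Ξ, ω ≠ ω' → L ≤ |s ω - s ω'| := fun ω hω ω' hω' hne' =>
    le_abs_natCast_mul_sub (fun h => hne' (hk hω hω' h)) hL0
  obtain ⟨f, hf, hproj, hsum⟩ := hex 1 fun ω _ => WithLp.toLp 2 (0, s ω)
  refine le_decouplingConst f hf (by positivity) hne ?_ fun ω hω => ?_
  · have hdisj : (Ξ : Set (Space d)).PairwiseDisjoint
        fun ω => Set.Ico (s ω) (s ω + (δ ^ 2)⁻¹ * P.ρ) := by
      intro ω hω ω' hω' hne'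
      rw [Function.onFun, Set.disjoint_left]
      intro t ht ht'
      have h1 := hss ω hω ω' hω' hne'
      have h2 : |s ω - s ω'| < (δ ^ 2)⁻¹ * P.ρ :=
        abs_lt.2 ⟨by linarith [ht.2, ht'.1], by linarith [ht.1, ht'.2]⟩
      linarith
    refine ofReal_le_mixedNorm (T := ⋃ ω ∈ Ξ, Set.Ico (s ω) (s ω + (δ ^ 2)⁻¹ * P.ρ)) hq hr
      (by positivity) (by positivity) (by positivity)
      (Finset.measurableSet_biUnion _ fun ω _ => measurableSet_Ico) ?_ fun t ht => ?_
    · rw [measure_biUnion_finset hdisj fun ω _ => measurableSet_Ico]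
      simp only [Real.volume_Ico, add_sub_cancel_left, Finset.sum_const, nsmul_eq_mul]
      rw [ENNReal.ofReal_mul (Nat.cast_nonneg _), ENNReal.ofReal_natCast]
    simp only [Set.mem_iUnion] at ht
    obtain ⟨ω, hω, ht⟩ := ht
    have htρ : |δ ^ 2 * (t - s ω)| ≤ P.ρ := by
      rw [abs_of_nonneg (mul_nonneg (by positivity) (sub_nonneg.2 ht.1))]
      calc δ ^ 2 * (t - s ω) ≤ δ ^ 2 * ((δ ^ 2)⁻¹ * P.ρ) := by gcongr; linarith [ht.2]
        _ = P.ρ := by field_simp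
    refine ⟨Metric.ball (-((2 * (t - s ω)) • ξ ω)) (P.ρ / δ), measurableSet_ball,
      (volume_ball_space _ (div_pos hρ hδ)).ge, fun x hx => ?_⟩
    rw [mem_ball_iff_norm, sub_neg_eq_add, lt_div_iff₀ hδ] at hx
    rw [hsum]
    simp only [Finset.sum_range_one]
    refine quarter_le_norm_sum (b := P.C * Λ⁻¹) (n := P.n) hω (by positivity)
      (fun ω hω => (hprop ω hω).2.2.2) ?_ (fun ω' hω' hne' => ?_) ?_
    · refine P.half_le_norm δ (ξ ω) (x - 0) (t - s ω) ?_ htρ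
      rw [sub_zero, norm_smul, Real.norm_eq_abs, abs_of_pos hδ]
      linarith
    · refine P.norm_packet_le_of_time (x := x - 0) (t := t - s ω') hΛ0 ?_
      have h1 := hss ω hω ω' hω' hne'.symm
      have h2 : δ ^ 2 * L ≤ |δ ^ 2 * (s ω - s ω')| := by
        rw [abs_mul, abs_of_pos (by positivity : 0 < δ ^ 2)]
        gcongr
      have h3 := abs_sub (δ ^ 2 * (t - s ω')) (δ ^ 2 * (t - s ω))
      rw [show δ ^ 2 * (t - s ω') - δ ^ 2 * (t - s ω) = δ ^ 2 * (s ω - s ω') by ring] at h3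
      linarith [P.ρ_le_one]
    · rw [hΛ]
      refine le_of_eq ?_
      field_simp
  · obtain ⟨-, hcard, -⟩ := hprop ω hω
    -- The packets in one projection may live at very different times, so the reference time depends
    -- on the frequency. With `M = 1` the separation condition is vacuous.
    have h := P.mixedNorm_sum_packet_le hq hr hδ hcard ξ 1 (fun _ _ => 0) (fun ω _ => s ω)
      s (fun ω' _ j hj => by simp) (fun ω' hω' i hi j hj hij => by omega) (hproj ω hω)
    simpa only [Nat.cast_one, one_mul] using h

/-! ### Comparison of powers -/

theorem toReal_inv_mem_Icc {p : ℝ≥0∞} (hp : 1 ≤ p) : (p⁻¹).toReal ∈ Set.Icc (0 : ℝ) 1 :=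
  ⟨ENNReal.toReal_nonneg, by
    simpa using ENNReal.toReal_mono ENNReal.one_ne_top (ENNReal.inv_le_one.2 hp)⟩

/-- The exponents that occur may have either sign, so comparability is needed in both directions;
`|e| ≤ 1` makes the loss at most `K`. -/
theorem inv_mul_rpow_le_rpow {x y K e : ℝ} (hx : 0 < x) (hy : 0 < y) (hK : 1 ≤ K)
    (hxy : x ≤ K * y) (hyx : y ≤ K * x) (he : |e| ≤ 1) : K⁻¹ * x ^ e ≤ y ^ e := by
  have hK0 : 0 < K := by linarith
  have hxe : 0 < x ^ e := Real.rpow_pos_of_pos hx e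
  rw [abs_le] at he
  rcases le_total 0 e with h | h
  · rw [inv_mul_le_iff₀ hK0]
    calc x ^ e ≤ (K * y) ^ e := Real.rpow_le_rpow hx.le hxy h
      _ = K ^ e * y ^ e := Real.mul_rpow hK0.le hy.le
      _ ≤ K ^ (1 : ℝ) * y ^ e := by gcongr; exact he.2
      _ = _ := by rw [Real.rpow_one]
  · calc K⁻¹ * x ^ e = K ^ (-1 : ℝ) * x ^ e := by rw [Real.rpow_neg_one]
      _ ≤ K ^ e * x ^ e := by gcongr; exact he.1
      _ = (K * x) ^ e := (Real.mul_rpow hK0.le hx.le).symm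
      _ ≤ y ^ e := Real.rpow_le_rpow_of_nonpos hy hyx h

/-- Used with `u = δ^d` and `v = δ²`, this splits off the factors independent of `N`, `M` and `δ`.
-/
theorem focusing_quotient_eq {N M R ρ u v I J k a b : ℝ} (hN : 0 < N) (hM : 0 < M) (hR : 0 < R)
    (hρ : 0 < ρ) (hu : 0 < u) (hv : 0 < v) (hI : 0 < I) (hJ : 0 < J) (hk : 0 < k) :
    (N / 4 * R ^ a * (M * ρ) ^ b) /
      (N ^ (1 / 2 : ℝ) * ((M * (u⁻¹ * I)) ^ a * (v⁻¹ * J) ^ b * k)) =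
    (4 * k)⁻¹ * (R / I) ^ a * (ρ / J) ^ b * (N ^ (1 / 2 : ℝ) * M ^ (b - a) * u ^ a * v ^ b) := by
  have hN2 : N = N ^ (1 / 2 : ℝ) * N ^ (1 / 2 : ℝ) := by
    rw [← Real.rpow_add hN]; norm_num
  rw [Real.mul_rpow hM.le hρ.le, Real.mul_rpow hM.le (by positivity),
    Real.mul_rpow (by positivity) hI.le, Real.mul_rpow (by positivity) hJ.le,
    Real.inv_rpow hu.le, Real.inv_rpow hv.le, Real.div_rpow hR.le hI.le, Real.div_rpow hρ.le hJ.le,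
    Real.rpow_sub hM]
  nth_rewrite 1 [hN2]
  have := Real.rpow_pos_of_pos hN (1 / 2)
  have := Real.rpow_pos_of_pos hM a
  have := Real.rpow_pos_of_pos hu a
  have := Real.rpow_pos_of_pos hv b
  have := Real.rpow_pos_of_pos hI a
  have := Real.rpow_pos_of_pos hJ b
  field_simp

theorem space_quotient_eq {N R ρ u v I J k a b : ℝ} (hN : 0 < N) (hR : 0 < R)
    (hρ : 0 < ρ) (hu : 0 < u) (hv : 0 < v) (hI : 0 < I) (hJ : 0 < J) (hk : 0 < k) :
    (1 / 4 * (N * (u⁻¹ * R)) ^ a * (v⁻¹ * ρ) ^ b) /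
      (N ^ (1 / 2 : ℝ) * ((u⁻¹ * I) ^ a * (v⁻¹ * J) ^ b * k)) =
    (4 * k)⁻¹ * (R / I) ^ a * (ρ / J) ^ b * N ^ (a - 1 / 2) := by
  rw [Real.mul_rpow hN.le (by positivity), Real.mul_rpow (by positivity) hR.le,
    Real.mul_rpow (by positivity) hρ.le,
    Real.mul_rpow (by positivity) hI.le, Real.mul_rpow (by positivity) hJ.le,
    Real.inv_rpow hu.le, Real.inv_rpow hv.le, Real.div_rpow hR.le hI.le, Real.div_rpow hρ.le hJ.le,
    Real.rpow_sub hN]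
  have := Real.rpow_pos_of_pos hN (1 / 2)
  have := Real.rpow_pos_of_pos hu a
  have := Real.rpow_pos_of_pos hv b
  have := Real.rpow_pos_of_pos hI a
  have := Real.rpow_pos_of_pos hJ b
  field_simp

theorem time_quotient_eq {N R ρ u v I J k a b : ℝ} (hN : 0 < N) (hR : 0 < R)
    (hρ : 0 < ρ) (hu : 0 < u) (hv : 0 < v) (hI : 0 < I) (hJ : 0 < J) (hk : 0 < k) :
    (1 / 4 * (u⁻¹ * R) ^ a * (N * (v⁻¹ * ρ)) ^ b) /
      (N ^ (1 / 2 : ℝ) * ((u⁻¹ * I) ^ a * (v⁻¹ * J) ^ b * k)) =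
    (4 * k)⁻¹ * (R / I) ^ a * (ρ / J) ^ b * N ^ (b - 1 / 2) := by
  -- Space and time play symmetric roles in the quotient.
  have h := space_quotient_eq (a := b) (b := a) hN hρ hR hv hu hJ hI hk
  rw [mul_right_comm, mul_comm ((u⁻¹ * I) ^ a), h, mul_right_comm (4 * k)⁻¹]

end MixedDecoupling

/-! ### Assembly of the four lower bounds. -/

open MixedDecoupling

theorem mainTheorem3 (d : ℕ) (hd : 1 ≤ d) :
    ∃ δ₀ : ℝ, 0 < δ₀ ∧ ∀ q r : ℝ≥0∞, 1 ≤ q → 1 ≤ r →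
      ∃ c : ℝ, 0 < c ∧ ∀ δ : ℝ, 0 < δ → δ < δ₀ →
        ∀ Ξ : Finset (MixedDecoupling.Space d),
          MixedDecoupling.IsMaximalNet d δ (Ξ : Set (MixedDecoupling.Space d)) →
          ENNReal.ofReal (c *
            max (max (δ ^ (-((d : ℝ) / 2 - d * (r⁻¹).toReal - 2 * (q⁻¹).toReal)))
                     (δ ^ (-((d : ℝ) * ((r⁻¹).toReal - 1 / 2)))))
                (max (δ ^ (-((d : ℝ) * ((q⁻¹).toReal - 1 / 2))))
                     (δ ^ (-((d : ℝ) / 2 - (d + 2) * (r⁻¹).toReal))))) ≤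
            MixedDecoupling.decouplingConst d q r δ Ξ := by
  obtain ⟨P⟩ := nonempty_packetFamily d hd
  have hC := P.C_pos
  have hI := P.I_pos
  have hJ := P.J_pos
  have hρ := P.ρ_pos
  have hn : (0 : ℝ) < P.n := by exact_mod_cast P.n_pos
  have hX := volume_ball_toReal_pos d
  set X := (volume (Metric.ball (0 : Space d) 1)).toReal
  refine ⟨1, one_pos, fun q r hq hr => ?_⟩
  set a := (r⁻¹).toReal with ha
  set b := (q⁻¹).toReal with hb
  obtain ⟨ha0, ha1⟩ : a ∈ Set.Icc (0 : ℝ) 1 := toReal_inv_mem_Icc hr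
  obtain ⟨hb0, hb1⟩ : b ∈ Set.Icc (0 : ℝ) 1 := toReal_inv_mem_Icc hq
  set K : ℝ := (2 * √d + 1) ^ d with hK
  have hK1 : 1 ≤ K := one_le_pow₀ (by linarith [Real.sqrt_nonneg (d : ℝ)])
  set c₁ : ℝ := (4 * (8 * P.C * P.n))⁻¹ * (P.ρ ^ d * X / P.I) ^ a * (P.ρ / P.J) ^ b with hc₁
  have hc₁0 : 0 < c₁ := by positivity
  -- `K` pays for replacing `N` by `δ^(-d)`, and `2` for rounding `δ⁻²` down to an integer.
  refine ⟨c₁ * (2 * K)⁻¹, by positivity, fun δ hδ hδ1 Ξ hΞ => ?_⟩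
  have hone := hΞ.one_le_card_mul hδ
  have hup : (Ξ.card : ℝ) * δ ^ d ≤ K := IsSeparatedIn.card_mul_le hδ hδ1 hΞ.prop
  have hN : (0 : ℝ) < Ξ.card := by
    by_contra h
    have : (Ξ.card : ℝ) = 0 := le_antisymm (not_lt.1 h) (Nat.cast_nonneg _)
    rw [this] at hone
    linarith
  have hne : Ξ.Nonempty := Finset.card_pos.1 (by exact_mod_cast hN)
  have hu : 0 < δ ^ d := by positivity
  have hv : 0 < δ ^ 2 := by positivity
  have hk : 0 < 8 * P.C * P.n := by positivity
  have hR : 0 < P.ρ ^ d * X := by positivity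
  have hc : c₁ * (2 * K)⁻¹ ≤ c₁ * K⁻¹ := by
    gcongr
    linarith
  have hc2 : c₁ * (2 * K)⁻¹ ≤ c₁ * 2⁻¹ := by
    gcongr
    linarith
  have hc3 : c₁ * (2 * K)⁻¹ ≤ c₁ :=
    hc.trans (mul_le_of_le_one_right hc₁0.le (inv_le_one_of_one_le₀ hK1))
  have hdpow : ∀ e : ℝ, ((δ ^ d)⁻¹) ^ e = δ ^ (-(d * e)) := fun e => by
    rw [← Real.rpow_natCast, ← Real.rpow_neg hδ.le, ← Real.rpow_mul hδ.le, neg_mul]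
  have hda : ∀ e : ℝ, (δ ^ d) ^ e = δ ^ (d * e) := fun e => by
    rw [← Real.rpow_natCast, ← Real.rpow_mul hδ.le]
  have h2pow : ∀ e : ℝ, (δ ^ 2) ^ e = δ ^ (2 * e) := fun e => by
    rw [← Real.rpow_natCast, ← Real.rpow_mul hδ.le, Nat.cast_ofNat]
  have hNlow : (δ ^ d)⁻¹ ≤ Ξ.card := by
    rwa [inv_le_iff_one_le_mul₀ hu]
  have hNup : (Ξ.card : ℝ) ≤ K * (δ ^ d)⁻¹ := by
    rwa [← div_eq_mul_inv, le_div_iff₀ hu]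
  have hNe : ∀ e : ℝ, |e| ≤ 1 → K⁻¹ * δ ^ (-(d * e)) ≤ (Ξ.card : ℝ) ^ e := fun e he => by
    rw [← hdpow]
    exact inv_mul_rpow_le_rpow (by positivity) hN hK1
      (hNlow.trans (le_mul_of_one_le_left hN.le hK1)) hNup he
  have hhalf : δ ^ (-((d : ℝ) * (1 / 2))) ≤ (Ξ.card : ℝ) ^ (1 / 2 : ℝ) := by
    rw [← hdpow]
    exact Real.rpow_le_rpow (by positivity) hNlow (by norm_num)
  have hfoc : ∀ M : ℕ, 1 ≤ M → δ ^ 2 * M ≤ 1 → ENNReal.ofReal (c₁ * (δ ^ (-((d : ℝ) * (1 / 2))) *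
      (M : ℝ) ^ (b - a) * δ ^ (d * a) * δ ^ (2 * b))) ≤ decouplingConst d q r δ Ξ := by
    intro M hM hMδ
    have hM0 : (0 : ℝ) < M := by exact_mod_cast hM
    refine le_trans (ENNReal.ofReal_le_ofReal ?_)
      (P.focusing_le_decouplingConst hd hq hr hδ hδ1 hΞ.prop hne hM hMδ)
    rw [focusing_quotient_eq hN hM0 hR hρ hu hv hI hJ hk, hda, h2pow]
    gcongr
  have hspace : ENNReal.ofReal (c₁ * (Ξ.card : ℝ) ^ (a - 1 / 2)) ≤ decouplingConst d q r δ Ξ := by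
    have h := P.space_le_decouplingConst hd hq hr hδ hδ1 hΞ.prop hne
    rwa [div_pow, div_eq_inv_mul _ (δ ^ d), mul_assoc (δ ^ d)⁻¹,
      space_quotient_eq hN hR hρ hu hv hI hJ hk] at h
  have htime : ENNReal.ofReal (c₁ * (Ξ.card : ℝ) ^ (b - 1 / 2)) ≤ decouplingConst d q r δ Ξ := by
    have h := P.time_le_decouplingConst hq hr hδ hδ1 hΞ.prop hne
    rwa [div_pow, div_eq_inv_mul _ (δ ^ d), mul_assoc (δ ^ d)⁻¹,
      time_quotient_eq hN hR hρ hu hv hI hJ hk] at h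
  have hδ2 : 1 ≤ (δ ^ 2)⁻¹ := (one_le_inv₀ hv).2 (pow_le_one₀ hδ.le hδ1.le)
  have h1 : ENNReal.ofReal (c₁ * (2 * K)⁻¹ * δ ^ (-((d : ℝ) / 2 - d * a - 2 * b))) ≤
      decouplingConst d q r δ Ξ := by
    refine le_trans (ENNReal.ofReal_le_ofReal ?_)
      (hfoc 1 le_rfl (by rw [Nat.cast_one, mul_one]; exact pow_le_one₀ hδ.le hδ1.le))
    rw [Nat.cast_one, Real.one_rpow, mul_one, ← Real.rpow_add hδ, ← Real.rpow_add hδ,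
      show -((d : ℝ) / 2 - d * a - 2 * b) = -((d : ℝ) * (1 / 2)) + d * a + 2 * b by ring]
    gcongr
  have h2 : ENNReal.ofReal (c₁ * (2 * K)⁻¹ * δ ^ (-((d : ℝ) * (a - 1 / 2)))) ≤
      decouplingConst d q r δ Ξ := by
    refine le_trans (ENNReal.ofReal_le_ofReal ?_) hspace
    have := hNe (a - 1 / 2) (abs_le.2 ⟨by linarith, by linarith⟩)
    calc _ ≤ c₁ * K⁻¹ * δ ^ (-((d : ℝ) * (a - 1 / 2))) := by gcongr
      _ = c₁ * (K⁻¹ * δ ^ (-((d : ℝ) * (a - 1 / 2)))) := mul_assoc _ _ _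
      _ ≤ _ := by gcongr
  have h3 : ENNReal.ofReal (c₁ * (2 * K)⁻¹ * δ ^ (-((d : ℝ) * (b - 1 / 2)))) ≤
      decouplingConst d q r δ Ξ := by
    refine le_trans (ENNReal.ofReal_le_ofReal ?_) htime
    have := hNe (b - 1 / 2) (abs_le.2 ⟨by linarith, by linarith⟩)
    calc _ ≤ c₁ * K⁻¹ * δ ^ (-((d : ℝ) * (b - 1 / 2))) := by gcongr
      _ = c₁ * (K⁻¹ * δ ^ (-((d : ℝ) * (b - 1 / 2)))) := mul_assoc _ _ _
      _ ≤ _ := by gcongr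
  have h4 : ENNReal.ofReal (c₁ * (2 * K)⁻¹ * δ ^ (-((d : ℝ) / 2 - (d + 2) * a))) ≤
      decouplingConst d q r δ Ξ := by
    -- The largest number of focusing points allowed by `δ² M ≤ 1`; it turns `M^(b - a)` into
    -- `δ^(-2(b - a))` up to a factor `2`, which cancels the dependence on `b`.
    set M := ⌊(δ ^ 2)⁻¹⌋₊ with hM
    have hMle : (M : ℝ) ≤ (δ ^ 2)⁻¹ := Nat.floor_le (by positivity)
    have hM1 : 1 ≤ M := Nat.le_floor (by exact_mod_cast hδ2)
    have hM1' : (1 : ℝ) ≤ M := by exact_mod_cast hM1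
    have hMge : (δ ^ 2)⁻¹ ≤ 2 * M := by
      have := (Nat.lt_floor_add_one (δ ^ 2)⁻¹).le
      linarith
    refine le_trans (ENNReal.ofReal_le_ofReal ?_) (hfoc M hM1 (by
      calc δ ^ 2 * M ≤ δ ^ 2 * (δ ^ 2)⁻¹ := by gcongr
        _ = 1 := mul_inv_cancel₀ hv.ne'))
    have hMe := inv_mul_rpow_le_rpow (e := b - a) (by positivity) (by linarith) one_le_two hMge
      (hMle.trans (by linarith)) (abs_le.2 ⟨by linarith, by linarith⟩)
    rw [Real.inv_rpow hv.le, h2pow, ← Real.rpow_neg hδ.le] at hMe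
    calc c₁ * (2 * K)⁻¹ * δ ^ (-((d : ℝ) / 2 - (d + 2) * a))
        ≤ c₁ * 2⁻¹ * δ ^ (-((d : ℝ) / 2 - (d + 2) * a)) := by gcongr
      _ = c₁ * (δ ^ (-((d : ℝ) * (1 / 2))) * (2⁻¹ * δ ^ (-(2 * (b - a)))) *
          δ ^ (d * a) * δ ^ (2 * b)) := by
        rw [show -((d : ℝ) / 2 - (d + 2) * a) =
          -((d : ℝ) * (1 / 2)) + -(2 * (b - a)) + d * a + 2 * b by ring,
          Real.rpow_add hδ, Real.rpow_add hδ, Real.rpow_add hδ]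
        ring
      _ ≤ _ := by gcongr
  rcases max_choice (max (δ ^ (-((d : ℝ) / 2 - d * a - 2 * b))) (δ ^ (-((d : ℝ) * (a - 1 / 2)))))
    (max (δ ^ (-((d : ℝ) * (b - 1 / 2)))) (δ ^ (-((d : ℝ) / 2 - (d + 2) * a)))) with h | h
  · rw [h]
    rcases max_choice (δ ^ (-((d : ℝ) / 2 - d * a - 2 * b))) (δ ^ (-((d : ℝ) * (a - 1 / 2))))
      with h | h <;> rw [h] <;> assumption
  · rw [h]
    rcases max_choice (δ ^ (-((d : ℝ) * (b - 1 / 2)))) (δ ^ (-((d : ℝ) / 2 - (d + 2) * a)))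
      with h | h <;> rw [h] <;> assumption
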